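/- Let $V=U\sqcup\{\delta\}$ be a finite set, $x_0\in U$, and let $G=(V,E)$, $E\subset V\times V$, be a directed graph without loops in which no edge has origin $\delta$, every $x\in U$ is joined to $\delta$ by a directed path, and $x_0$ is joined to every $x\in U$ by a directed path. Write $e=(\underline e,\overline e)$. Let $\alpha_e>0$ $(e\in E)$, put $\beta_x=\sum_{\underline e=x}\alpha_e$ $(x\in U)$ and $C_\alpha=\prod_{x\in U}\Gamma(\beta_x)/\prod_{e\in E}\Gamma(\alpha_e)$. *Environment.* Let $\tilde\Delta=\{p\in(0,1]^E:\ \sum_{\underline e=x}p_e=1\ \ \forall x\in U\}$, and let $\mathbb E^{(\alpha)}$ be the expectation for the Dirichlet law on $\tilde\Delta$ with density $C_\alpha\prod_e p_e^{\alpha_e-1}$ with respect to $\prod_{e\in\tilde E}dp_e$, where $\tilde E$ is obtained from $E$ by removing, for each $x\in U$, an arbitrary edge with origin $x$. For $p\in\tilde\Delta$ let $P_U$ be the transition matrix, restricted to $U\times U$, of the Markov chain with exit probabilities $(p_e)_{\underline e=x}$ at $x\in U$, stopped at $\delta$; let $G^p_U=(I-P_U)^{-1}$ and $z_e=G^p_U(x_0,\underline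 e)\,p_e$. *Bipartite graph.* Let $\hat G$ have vertices $x_-,x_+$ $(x\in U)$ and $\delta$, and edges $\hat e_x=(x_-,x_+)$ for $x\in U$ and, for $e=(x,y)\in E$, $\hat e=(x_+,y_-)$ if $y\ne\delta$, $\hat e=(x_+,\delta)$ if $y=\delta$; denote by $\hat E$ its set of edges and put $\alpha_{\hat e}=\alpha_e$, $\alpha_{\hat e_x}=-\beta_x$. Let $\Delta$ be the set of $z\in(0,\infty)^{\hat E}$ such that $\sum_{\underline f=v}z_f-\sum_{\overline f=v}z_f=\mathbf 1_{v=(x_0)_-}$ for every vertex $v\neq\delta$ of $\hat G$. A spanning tree of $G$ is a set of edges that contains no cycle and contains a path (edges being usable in both directions) between any two vertices; it is directed (towards $\delta$) if it contains exactly one edge with origin $x$ for each $x\in U$. For a directed spanning tree $T$ of $G$ let $\hat T=\{\hat e: e\in T\}\cup\{\hat e_x: x\in U\}$, write $\hat E\setminus\hat T=\{f_1,\dots,f_n\}$, and set $\omega_{\hat T}=\frac{dz_{f_1}}{z_{f_1}}\wedge\cdots\wedge\frac{dz_{f_n}}{z_{f_n}}$, positively oriented, so that integrating against $\omega_{\hat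 T}$ over $\Delta$ means integrating against $\prod_i z_{f_i}^{-1}dz_{f_i}$ in the coordinates $z_{f_1},\dots,z_{f_n}$. **Theorem.** For every directed spanning tree $T$ of $G$ and every $\lambda\in\mathbb C^E$ with $\Re\lambda_e>0$ for all $e\in E$, both sides of the following identity are well defined ($\det(I-P_U)\neq0$ for every $p\in\tilde\Delta$, and both integrals converge absolutely), and $$C_\alpha\int_\Delta e^{-\sum_{e\in E}\lambda_e z_{\hat e}}\Big(\prod_{f\in\hat E}z_f^{\alpha_f}\Big)\,\omega_{\hat T}=\mathbb E^{(\alpha)}\left[e^{-\sum_{e\in E}\lambda_e z_e}\,\frac{\prod_{e\in T}p_e}{\det(I-P_U)}\right].$$ Moreover, for every $p\in\tilde\Delta$ and $e\in E$, $z_e=G^p_U(x_0,\underline e)\,p_e$ is the expected number of crossings of the edge $e$, before hitting $\delta$, by the Markov chain started at $x_0$ with exit probabilities $p$. -/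

import Mathlib

open MeasureTheory
open scoped ENNReal

noncomputable section

/-- A directed graph without loops and without multiple edges on the vertex set
`V = U ⊔ {δ}`, encoded as `Option U` with `δ = none`.  The edges are indexed by `E`, and `e ↦ (tail e, head e)`
embeds `E` into `V × V`; no edge has origin `δ`, since `tail` takes values in `U`. -/
structure KilledGraph (U E : Type*) where
  tail : E → U
  head : E → Option U
  simple : ∀ e e', tail e = tail e' → head e = head e' → e = e'
  noLoop : ∀ e, head e ≠ some (tail e)

namespace KilledGraph

variable {U E : Type*} (G : KilledGraph U E)

/-- The edge `e` is `(a, b)`. -/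
def IsArc (e : E) (a b : Option U) : Prop := some (G.tail e) = a ∧ G.head e = b

/-- `S` contains a simple path from `a` to `b`, in which edges may be used in either direction. -/
def ContainsPath (S : Set E) (a b : Option U) : Prop :=
  ∃ (k : ℕ) (v : Fin (k + 1) → Option U) (e : Fin k → E),
    Function.Injective v ∧ v 0 = a ∧ v (Fin.last k) = b ∧ (∀ j, e j ∈ S) ∧
      ∀ j, G.IsArc (e j) (v j.castSucc) (v j.succ) ∨ G.IsArc (e j) (v j.succ) (v j.castSucc)

/-- `S` contains a directed simple path from `a` to `b`. -/
def ContainsDirectedPath (S : Set E) (a b : Option U) : Prop :=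
  ∃ (k : ℕ) (v : Fin (k + 1) → Option U) (e : Fin k → E),
    Function.Injective v ∧ v 0 = a ∧ v (Fin.last k) = b ∧ (∀ j, e j ∈ S) ∧
      ∀ j, G.IsArc (e j) (v j.castSucc) (v j.succ)

/-- `S` contains a simple cycle: distinct vertices `v 0, …, v k` and distinct edges, the
`j`-th of which joins `v j` and `v (j + 1)`, in either direction and with indices
modulo `k + 1`. -/
def ContainsCycle (S : Set E) : Prop :=
  ∃ (k : ℕ) (v : Fin (k + 1) → Option U) (e : Fin (k + 1) → E),
    Function.Injective v ∧ Function.Injective e ∧ (∀ j, e j ∈ S) ∧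
      ∀ j, G.IsArc (e j) (v j) (v (j + 1)) ∨ G.IsArc (e j) (v (j + 1)) (v j)

def IsSpanningTree (T : Finset E) : Prop :=
  ¬ G.ContainsCycle (T : Set E) ∧ ∀ a b : Option U, a ≠ b → G.ContainsPath (T : Set E) a b

/-- A spanning tree directed towards `δ`. -/
def IsDirectedSpanningTree (T : Finset E) : Prop :=
  G.IsSpanningTree T ∧ ∀ x : U, ∃! e, e ∈ T ∧ G.tail e = x

/-- Every vertex is connected to `δ`, and `x₀` to every vertex, by a directed simple path. -/
structure IsAdmissible (x₀ : U) : Prop where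
  toCemetery : ∀ x : U, G.ContainsDirectedPath Set.univ (some x) none
  fromBase : ∀ x : U, x ≠ x₀ → G.ContainsDirectedPath Set.univ (some x₀) (some x)

/-- The bipartite graph obtained by duplicating each `x ∈ U` into `x₋ = (false, x)` and
`x₊ = (true, x)`.  An edge `e = (x, y)` gives `ê = (x₊, y₋)` (indexed by `Sum.inl e`), or `(x₊, δ)` if
`y = δ`, and a vertex `x ∈ U` gives `ê_x = (x₋, x₊)` (indexed by `Sum.inr x`). -/
def hat : KilledGraph (Bool × U) (E ⊕ U) where
  tail := Sum.elim (fun e => (true, G.tail e)) (fun x => (false, x))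
  head := Sum.elim (fun e => (G.head e).map (fun y => (false, y))) (fun x => some (true, x))
  simple := by
    rintro (e | x) (e' | x') h₁ h₂
    · simp only [Sum.elim_inl, Prod.mk.injEq, true_and] at h₁ h₂
      exact congrArg _ (G.simple e e' h₁ (Option.map_injective (Prod.mk_right_injective _) h₂))
    · simp at h₁
    · simp at h₁
    · simpa using h₁
  noLoop := by
    rintro (e | x) <;> simp

variable [Fintype U] [DecidableEq U] [Fintype E] [DecidableEq E]

/-! ### Environments and the Markov chain -/

/-- The set of environments: weights in `(0, 1]` that sum to one at every vertex of `U`. -/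
def environments : Set (E → ℝ) :=
  {p | (∀ e, 0 < p e ∧ p e ≤ 1) ∧ ∀ x, ∑ e with G.tail e = x, p e = 1}

/-- The measure `∏ dp_e` on the environments, the product being over all edges but one chosen
edge `r x` with origin `x` for each `x ∈ U`. -/
def environmentVolume (r : U → E) : Measure G.environments :=
  (volume : Measure ({e : E // e ≠ r (G.tail e)} → ℝ)).comap
    (fun (p : G.environments) (e : {e : E // e ≠ r (G.tail e)}) => (p : E → ℝ) e)

/-- `β_x`, the sum of the weights of the edges with origin `x`. -/
def outWeight (α : E → ℝ) (x : U) : ℝ := ∑ e with G.tail e = x, α e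

/-- `C_α = ∏_x Γ(β_x) / ∏_e Γ(α_e)`. -/
def normConst (α : E → ℝ) : ℝ :=
  (∏ x, Real.Gamma (G.outWeight α x)) / ∏ e, Real.Gamma (α e)

/-- The law of the Dirichlet environment with weights `α`. -/
def dirichletLaw (r : U → E) (α : E → ℝ) : Measure G.environments :=
  (G.environmentVolume r).withDensity
    (fun p => ENNReal.ofReal (G.normConst α * ∏ e, (p : E → ℝ) e ^ (α e - 1)))

/-- Transition probabilities on `V`; the vertex `δ` is absorbing. -/
def step (p : E → ℝ) : Option U → Option U → ℝ
  | some x, b => ∑ e with G.tail e = x ∧ G.head e = b, p e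
  | none, b => if b = none then 1 else 0

/-- The transition matrix restricted to `U × U`. -/
def transitionMatrix (p : E → ℝ) : Matrix U U ℝ :=
  Matrix.of fun x y => G.step p (some x) (some y)

/-- The Green function `(I - P_U)⁻¹` of the chain killed at `δ`. -/
def green (p : E → ℝ) : Matrix U U ℝ := (1 - G.transitionMatrix p)⁻¹

/-- `z_e = G_U(x₀, tail e) p_e`. -/
def occupation (x₀ : U) (p : E → ℝ) (e : E) : ℝ := G.green p x₀ (G.tail e) * p e

/-- `X` is, under `ℙ`, a Markov chain on `V` started at `x₀`, stopped at `δ`, with exit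
probabilities `p`. -/
structure IsMarkovChain (x₀ : U) (p : E → ℝ) {Ω : Type*} [MeasurableSpace Ω] (ℙ : Measure Ω)
    (X : ℕ → Ω → Option U) : Prop where
  measurable : ∀ n b, MeasurableSet {ω | X n ω = b}
  law : ∀ (n : ℕ) (v : ℕ → Option U), ℙ {ω | ∀ i ≤ n, X i ω = v i} =
    if v 0 = some x₀ then ENNReal.ofReal (∏ i ∈ Finset.range n, G.step p (v i) (v (i + 1))) else 0

/-- The expected number of crossings of `e` by `X` before the hitting time of `δ`. -/
def expectedCrossings {Ω : Type*} [MeasurableSpace Ω] (ℙ : Measure Ω)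
    (X : ℕ → Ω → Option U) (e : E) : ℝ≥0∞ :=
  ∫⁻ ω, ∑' k : ℕ, Set.indicator
    {ω | (∀ j ≤ k, X j ω ≠ none) ∧ X k ω = some (G.tail e) ∧ X (k + 1) ω = G.head e} 1 ω ∂ℙ

/-! ### The arrangement and its hypergeometric integrals -/

def divergence (θ : E → ℝ) (x : U) : ℝ :=
  ∑ e with G.tail e = x, θ e - ∑ e with G.head e = some x, θ e

/-- The affine space `{z | div z = δ_{x₀}}`. -/
def flowSpace (x₀ : U) : Set (E → ℝ) := {z | G.divergence z = Pi.single x₀ 1}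

/-- The domain of the arrangement on which all `z_e` are positive. -/
def domain (x₀ : U) : Set (G.flowSpace x₀) := {z | ∀ e, 0 < (z : E → ℝ) e}

/-- For a spanning tree `T` with complement `{e₁, …, eₙ}`, the functions `z_{e₁}, …, z_{eₙ}` are
global affine coordinates on the flow space.  This is the measure defined there by
the positively oriented form `dz_{e₁} ∧ ⋯ ∧ dz_{eₙ}`, i.e. Lebesgue measure in these coordinates. -/
def coordVolume (x₀ : U) (T : Finset E) : Measure (G.flowSpace x₀) :=
  (volume : Measure ({e : E // e ∉ T} → ℝ)).comap
    (fun (z : G.flowSpace x₀) (e : {e : E // e ∉ T}) => (z : E → ℝ) e)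

/-- The coefficient of `e^{-⟨λ,z⟩} ∏_e z_e^{α_e} ω_T` with respect to `dz_{e₁} ∧ ⋯ ∧ dz_{eₙ}`, where
`ω_T = dz_{e₁}/z_{e₁} ∧ ⋯ ∧ dz_{eₙ}/z_{eₙ}` and `{e₁, …, eₙ}` is the complement of `T`. -/
def hyperIntegrand (T : Finset E) (α : E → ℝ) (l : E → ℂ) (z : E → ℝ) : ℂ :=
  Complex.exp (-∑ e, l e * (z e : ℂ)) * ((∏ e, z e ^ α e : ℝ) : ℂ) * ((∏ e ∈ Tᶜ, (z e)⁻¹ : ℝ) : ℂ)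

/-- The integral `∫_Δ e^{-⟨λ,z⟩} ∏_e z_e^{α_e} ω_T` converges absolutely. -/
def HyperIntegrable (x₀ : U) (T : Finset E) (α : E → ℝ) (l : E → ℂ) : Prop :=
  IntegrableOn (fun z : G.flowSpace x₀ => hyperIntegrand T α l z) (G.domain x₀)
    (G.coordVolume x₀ T)

/-- The hypergeometric integral `I_{Δ,T}(λ) = ∫_Δ e^{-⟨λ,z⟩} ∏_e z_e^{α_e} ω_T`. -/
def hyperIntegral (x₀ : U) (T : Finset E) (α : E → ℝ) (l : E → ℂ) : ℂ :=
  ∫ z in G.domain x₀, hyperIntegrand T α l (z : E → ℝ) ∂(G.coordVolume x₀ T)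

/-! ### Weights, trees and parameters on the bipartite graph -/

/-- The weights on the bipartite graph: `α_e` on `ê`, and `-β_x` on `ê_x`. -/
def hatWeight (α : E → ℝ) : E ⊕ U → ℝ := Sum.elim α (fun x => -G.outWeight α x)

/-- The tree of the bipartite graph associated with `T`: all `ê` with `e ∈ T`, and all `ê_x`. -/
def hatTree (T : Finset E) : Finset (E ⊕ U) := T.disjSum Finset.univ

/-- A function on the edges of the graph, extended by zero to the edges `ê_x`. -/
def hatParam (l : E → ℂ) : E ⊕ U → ℂ := Sum.elim l 0

end KilledGraph

end

noncomputable section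

set_option linter.unusedSectionVars false

/-! The identity is a change of variables. A positive flow `z` on the bipartite graph determines the
environment p_e = z_ê / z_{ê_x}, where x is the origin of e. Conversely, if g_x = z_{ê_x} is the
flow through x, conservation reads g(I - P_U) = δ_{x₀}. So g is the row G_U(x₀, ·) of the Green
function and z_ê = g_x p_e. This makes Δ and the set of environments correspond bijectively; the
flow of an environment is positive because x₀ reaches every vertex (`injOn_flowChart`,
`image_flowChart`).

Use as coordinates the edges off T on both sides, and write T as a section t : U → E. The quotient
rule gives a Jacobian matrix that is diagonal times a perturbation of the identity factoring through
ℝ^U. Sylvester's identity det(1 - AB) = det(1 - BA) moves the determinant to U × U, where it becomes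
det(I - P_U) / det(I - S), with S the matrix of the walk along t. Since T has no cycle, det(I - S) =
1. The Jacobian is therefore det(I - P_U) times the product of 1/g over the origins of the edges off
T (`det_flowJacobian`). The weights -β_x cancel the remaining powers of g, and the missing factors
1/p_e, e ∈ T, produce the product over T on the right (`density_identity`).

Convergence is proved on the environment side and carried over by the same change of variables. The
product of p_e over T is at most det(I - P_U): it is a single term of a matrix-tree expansion whose
remainder is nonnegative (`prod_section_le_det`). Together with Re λ > 0 this bounds the integrand
by 1, and the Dirichlet law is finite (`integrable_dirichletDensity`). Its exact mass plays no role,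
as C_α is a common factor. The crossing formula is the Neumann series of the Green function
(`hasSum_green`). -/

/-- A real matrix with nonpositive off-diagonal entries and nonnegative row sums has
nonnegative determinant. -/
theorem Matrix.det_nonneg_of_offDiag_nonpos {n : Type*} [Fintype n] [DecidableEq n]
    (A : Matrix n n ℝ) (hoff : ∀ i j, i ≠ j → A i j ≤ 0) (hrow : ∀ i, 0 ≤ ∑ j, A i j) :
    0 ≤ A.det := by
  -- Interpolation to the identity: for 0 < s ≤ 1 the matrix is strictly diagonally dominant, so its
  -- determinant does not vanish and keeps the sign it has at s = 1. The matrix `A` itself may be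
  -- singular and is reached only as a limit.
  let B : ℝ → Matrix n n ℝ := fun s => (1 - s) • A + s • (1 : Matrix n n ℝ)
  have hB : Continuous fun s => (B s).det := by
    apply Continuous.matrix_det
    fun_prop
  have hne : ∀ s ∈ Set.Ioc (0 : ℝ) 1, (B s).det ≠ 0 := by
    intro s hs
    apply det_ne_zero_of_sum_row_lt_diag
    intro k
    have h1 : ∑ j ∈ Finset.univ.erase k, ‖B s k j‖ = -((1 - s) * ∑ j ∈ Finset.univ.erase k, A k j) := by
      rw [Finset.mul_sum, ← Finset.sum_neg_distrib]
      refine Finset.sum_congr rfl fun j hj => ?_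
      have hkj : k ≠ j := (Finset.ne_of_mem_erase hj).symm
      have : B s k j = (1 - s) * A k j := by simp [B, Matrix.one_apply_ne hkj]
      rw [this, Real.norm_of_nonpos]
      exact mul_nonpos_of_nonneg_of_nonpos (by linarith [hs.2]) (hoff _ _ hkj)
    have h2 : B s k k = (1 - s) * A k k + s := by simp [B]
    have h3 := Finset.add_sum_erase Finset.univ (fun j => A k j) (Finset.mem_univ k)
    have h4 : 0 ≤ (1 - s) * ∑ j, A k j := mul_nonneg (by linarith [hs.2]) (hrow k)
    rw [← h3] at h4
    rw [h1, h2]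
    refine lt_of_lt_of_le ?_ (le_abs_self _)
    have := hs.1
    linarith
  have hpos : ∀ s ∈ Set.Ioc (0 : ℝ) 1, 0 < (B s).det := by
    intro s hs
    by_contra hneg
    have hneg' : (B s).det ≤ 0 := not_lt.mp hneg
    have h1 : (B 1).det = 1 := by simp [B]
    obtain ⟨u, hu, hu0⟩ := intermediate_value_Icc hs.2 hB.continuousOn
      (show (0 : ℝ) ∈ Set.Icc _ _ from ⟨hneg', by simp [h1]⟩)
    exact hne u ⟨hs.1.trans_le hu.1, hu.2⟩ hu0
  have hlim : Filter.Tendsto (fun s => (B s).det) (nhdsWithin 0 (Set.Ioi 0)) (nhds (B 0).det) :=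
    (hB.tendsto 0).mono_left nhdsWithin_le_nhds
  have h0 : (B 0).det = A.det := by simp [B]
  rw [← h0]
  refine ge_of_tendsto hlim ?_
  filter_upwards [Ioc_mem_nhdsGT (zero_lt_one' ℝ)] with s hs using (hpos s hs).le

/-! ### Directed trees as acyclic sections of the origin map -/

namespace KilledGraph

variable {U E : Type*} (G : KilledGraph U E)

/-- The successor map on `V` when every vertex `x ∈ U` is left along the edge `t x`. -/
def next (t : U → E) : Option U → Option U
  | some x => G.head (t x)
  | none => none

theorem IsDirectedSpanningTree.exists_section {G : KilledGraph U E} {T : Finset E}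
    (hT : G.IsDirectedSpanningTree T) :
    ∃ t : U → E, (∀ x, G.tail (t x) = x) ∧ ∀ e, e ∈ T ↔ e = t (G.tail e) := by
  choose t ht using fun x => (hT.2 x).exists
  refine ⟨t, fun x => (ht x).2, fun e => ⟨fun he => ?_, fun he => he ▸ (ht _).1⟩⟩
  exact (hT.2 (G.tail e)).unique ⟨he, rfl⟩ (ht _)

/-- An orbit that avoids δ stays in a finite set, hence reaches a periodic point. One minimal period
of it is a simple cycle made of edges of the section. -/
theorem exists_next_iterate_eq_none [Finite U] {t : U → E} (ht : ∀ x, G.tail (t x) = x)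
    (hcyc : ¬ G.ContainsCycle (Set.range t)) (a : Option U) : ∃ n, (G.next t)^[n] a = none := by
  set N := G.next t with hN
  by_contra! hne
  obtain ⟨i, j, hij, hval⟩ : ∃ i j, i < j ∧ N^[i] a = N^[j] a := by
    have := not_injective_infinite_finite (fun n : ℕ => N^[n] a)
    simp only [Function.Injective, not_forall] at this
    obtain ⟨i, j, h, hij⟩ := this
    rcases lt_or_gt_of_ne hij with h' | h'
    · exact ⟨i, j, h', h⟩
    · exact ⟨j, i, h', h.symm⟩
  set y := N^[i] a with hy
  have hper : Function.IsPeriodicPt N (j - i) y := by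
    rw [Function.IsPeriodicPt, Function.IsFixedPt, hy, ← Function.iterate_add_apply,
      Nat.sub_add_cancel hij.le, ← hval]
  have hmem : y ∈ Function.periodicPts N := ⟨j - i, Nat.sub_pos_of_lt hij, hper⟩
  have hpos := Function.minimalPeriod_pos_of_mem_periodicPts hmem
  obtain ⟨k, hk⟩ : ∃ k, Function.minimalPeriod N y = k + 1 := ⟨_, (Nat.succ_pred_eq_of_pos hpos).symm⟩
  have hsome : ∀ n, ∃ x, N^[n] y = some x := by
    intro n
    apply Option.ne_none_iff_exists'.mp
    rw [hy, ← Function.iterate_add_apply]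
    exact hne _
  choose x hx using hsome
  have hinj : Function.Injective fun j : Fin (k + 1) => N^[(j : ℕ)] y := by
    intro i j h
    have := Function.iterate_injOn_Iio_minimalPeriod (f := N) (x := y)
      (Set.mem_Iio.mpr (by rw [hk]; exact i.2)) (Set.mem_Iio.mpr (by rw [hk]; exact j.2)) h
    exact Fin.ext this
  refine hcyc ⟨k, fun j => N^[(j : ℕ)] y, fun j => t (x j), hinj, ?_, fun j => ⟨_, rfl⟩, ?_⟩
  · intro i j h
    apply hinj
    have h' := congrArg G.tail h
    simp only [ht] at h'
    simp only [hx, h']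
  · intro j
    left
    refine ⟨by rw [ht, ← hx], ?_⟩
    have h1 : G.head (t (x j)) = N^[(j : ℕ) + 1] y := by
      rw [Function.iterate_succ_apply', hx]
      rfl
    rw [h1]
    -- Addition in `Fin (k + 1)` wraps around exactly at the minimal period, which closes the cycle.
    have h2 : ((j + 1 : Fin (k + 1)) : ℕ) = ((j : ℕ) + 1) % Function.minimalPeriod N y := by
      rw [hk, Fin.val_add]
      simp
    simp only [h2, Function.iterate_mod_minimalPeriod_eq]

/-- The edges that are not chosen by `r`. -/
abbrev Coord (r : U → E) : Type _ := {e : E // e ≠ r (G.tail e)}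

variable [Fintype U] [DecidableEq U] [Fintype E] [DecidableEq E]

/-- The transition matrix of the deterministic walk leaving `x` along `t x`. -/
def sectionMatrix (t : U → E) : Matrix U U ℝ :=
  Matrix.of fun x y => if G.head (t x) = some y then 1 else 0

/-- Each step along the section strictly decreases the number of steps `d` left before δ. Ordered by
`d`, the matrix is block triangular with identity diagonal blocks. -/
theorem det_one_sub_sectionMatrix {t : U → E} (ht : ∀ x, G.tail (t x) = x)
    (hcyc : ¬ G.ContainsCycle (Set.range t)) : (1 - G.sectionMatrix t).det = 1 := by
  classical
  have hex := fun x : U => G.exists_next_iterate_eq_none ht hcyc (some x)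
  let d : U → ℕ := fun x => Nat.find (hex x)
  have hd : ∀ x y, G.head (t x) = some y → d y < d x := by
    intro x y hxy
    have h1 : (G.next t)^[d x] (some x) = none := Nat.find_spec (hex x)
    obtain ⟨m, hm⟩ : ∃ m, d x = m + 1 := by
      cases h : d x with
      | zero => simp [h] at h1
      | succ m => exact ⟨m, rfl⟩
    rw [hm, Function.iterate_succ_apply] at h1
    have h2 : G.next t (some x) = some y := hxy
    rw [h2] at h1
    have : d y ≤ m := Nat.find_min' (hex y) h1
    omega
  have hzero : ∀ x y, d x ≤ d y → G.sectionMatrix t x y = 0 := by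
    intro x y h
    simp only [sectionMatrix, Matrix.of_apply, ite_eq_right_iff]
    intro hxy
    exact absurd (hd x y hxy) (not_lt.mpr h)
  have htri : (1 - G.sectionMatrix t).BlockTriangular (OrderDual.toDual ∘ d) := by
    intro x y h
    have h' : d x < d y := h
    have hne : x ≠ y := by rintro rfl; exact lt_irrefl _ h'
    simp [Matrix.one_apply_ne hne, hzero x y h'.le]
  rw [htri.det]
  refine Finset.prod_eq_one fun k _ => ?_
  have : (1 - G.sectionMatrix t).toSquareBlock (OrderDual.toDual ∘ d) k = 1 := by
    ext ⟨x, hx⟩ ⟨y, hy⟩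
    have h : d x = d y := OrderDual.toDual.injective (hx.trans hy.symm)
    simp [Matrix.toSquareBlock_def, hzero x y h.le, Matrix.one_apply]
  rw [this, Matrix.det_one]

/-! ### Lower bound on the determinant -/

theorem transitionMatrix_apply (p : E → ℝ) (x y : U) :
    G.transitionMatrix p x y = ∑ e with G.tail e = x ∧ G.head e = some y, p e := rfl

theorem transitionMatrix_nonneg {p : E → ℝ} (hp : ∀ e, 0 ≤ p e) (x y : U) :
    0 ≤ G.transitionMatrix p x y := by
  rw [transitionMatrix_apply]
  exact Finset.sum_nonneg fun e _ => hp e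

theorem sum_transitionMatrix_le {p : E → ℝ} (hp : ∀ e, 0 ≤ p e) (x : U) :
    ∑ y, G.transitionMatrix p x y ≤ ∑ e with G.tail e = x, p e := by
  have h1 : ∑ y, G.transitionMatrix p x y
      = ∑ e with G.tail e = x, ∑ y, if G.head e = some y then p e else 0 := by
    rw [Finset.sum_comm]
    refine Finset.sum_congr rfl fun y _ => ?_
    rw [transitionMatrix_apply, ← Finset.filter_filter, Finset.sum_filter]
  rw [h1]
  refine Finset.sum_le_sum fun e _ => ?_
  cases h : G.head e with
  | none => simp [hp e]
  | some z => simp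

/-- Rows of I - P are exchanged one at a time for rows of I - S. By linearity in the row x the
determinant splits into p(t x) times the exchanged one plus a remainder, and the remainder keeps the
sign pattern for which determinants are nonnegative. -/
theorem prod_mul_det_le {p : E → ℝ} (hp : p ∈ G.environments) {t : U → E}
    (ht : ∀ x, G.tail (t x) = x) :
    (∏ x, p (t x)) * (1 - G.sectionMatrix t).det ≤ (1 - G.transitionMatrix p).det := by
  have hp0 : ∀ e, 0 ≤ p e := fun e => (hp.1 e).1.le
  let row : Finset U → Matrix U U ℝ := fun S => Matrix.of fun x =>
    if x ∈ S then (1 - G.sectionMatrix t) x else (1 - G.transitionMatrix p) x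
  -- the part of the transition matrix that avoids the section
  let p' : E → ℝ := fun e => if e = t (G.tail e) then 0 else p e
  have hp' : ∀ e, 0 ≤ p' e := fun e => by
    simp only [p']; split_ifs <;> simp [hp0]
  have hsplit : ∀ x y, G.transitionMatrix p x y
      = p (t x) * G.sectionMatrix t x y + G.transitionMatrix p' x y := by
    intro x y
    have h1 : p (t x) * G.sectionMatrix t x y
        = ∑ e with G.tail e = x ∧ G.head e = some y, if e = t (G.tail e) then p e else 0 := by
      simp only [sectionMatrix, Matrix.of_apply, Finset.sum_filter]
      rw [Finset.sum_eq_single (t x)]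
      · simp [ht]
      · intro e _ hne
        split_ifs with h2 h3
        · exact absurd (h2.1 ▸ h3) hne
        · rfl
        · rfl
      · simp
    rw [h1, transitionMatrix_apply, transitionMatrix_apply, ← Finset.sum_add_distrib]
    refine Finset.sum_congr rfl fun e _ => ?_
    simp only [p']; split_ifs <;> simp
  have hsum' : ∀ x, ∑ y, G.transitionMatrix p' x y ≤ 1 - p (t x) := by
    intro x
    refine (G.sum_transitionMatrix_le hp' x).trans (le_of_eq ?_)
    rw [← hp.2 x, eq_sub_iff_add_eq]
    have h1 : p (t x) = ∑ e with G.tail e = x, if e = t (G.tail e) then p e else 0 := by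
      rw [Finset.sum_filter, Finset.sum_eq_single (t x)]
      · simp [ht]
      · intro e _ hne
        split_ifs with h2 h3
        · exact absurd (h2 ▸ h3) hne
        · rfl
        · rfl
      · simp
    rw [h1, ← Finset.sum_add_distrib]
    refine Finset.sum_congr rfl fun e _ => ?_
    simp only [p']; split_ifs <;> simp
  have hsec0 : ∀ x y, 0 ≤ G.sectionMatrix t x y := by
    intro x y
    simp only [sectionMatrix, Matrix.of_apply]; split_ifs <;> simp
  have hsec1 : ∀ x, ∑ y, G.sectionMatrix t x y ≤ 1 := by
    intro x
    simp only [sectionMatrix, Matrix.of_apply]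
    cases h : G.head (t x) <;> simp
  have hrow_off : ∀ S i j, i ≠ j → row S i j ≤ 0 := by
    intro S i j hij
    simp only [row, Matrix.of_apply]
    split_ifs
    · simp [Matrix.one_apply_ne hij, hsec0]
    · simp [Matrix.one_apply_ne hij, G.transitionMatrix_nonneg hp0]
  have hrow_sum : ∀ S i, 0 ≤ ∑ j, row S i j := by
    intro S i
    simp only [row, Matrix.of_apply]
    split_ifs
    · simp [Matrix.one_apply, hsec1]
    · have := G.sum_transitionMatrix_le hp0 i
      rw [hp.2 i] at this
      simp [Matrix.one_apply, this]
  have key : ∀ S : Finset U, (∏ x ∈ S, p (t x)) * (row S).det ≤ (1 - G.transitionMatrix p).det := by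
    intro S
    induction S using Finset.induction_on with
    | empty =>
      have : row ∅ = 1 - G.transitionMatrix p := by ext; simp [row]
      simp [this]
    | insert x S hx ih =>
      rw [Finset.prod_insert hx]
      refine le_trans ?_ ih
      have h1 : row (insert x S) = (row S).updateRow x ((1 - G.sectionMatrix t) x) := by
        ext i j
        by_cases hi : i = x
        · subst hi; simp [row]
        · simp [row, hi]
      -- What is left of row x of I - P after removing p(t x) times row x of I - S. The edges
      -- avoiding t x carry total mass 1 - p(t x), so its entries sum to a nonnegative number.
      let v : U → ℝ := fun y => (if x = y then 1 - p (t x) else 0) - G.transitionMatrix p' x y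
      have h2 : row S = (row S).updateRow x (p (t x) • (1 - G.sectionMatrix t) x + v) := by
        ext i j
        by_cases hi : i = x
        · subst hi
          simp only [row, Matrix.of_apply, hx, if_false, Matrix.updateRow_self, Pi.add_apply,
            Pi.smul_apply, smul_eq_mul, v, Matrix.sub_apply, hsplit, Matrix.one_apply]
          split_ifs <;> ring
        · simp [hi]
      have h3 : (row S).det = p (t x) * (row (insert x S)).det + ((row S).updateRow x v).det := by
        rw [h1]
        conv_lhs => rw [h2]
        rw [Matrix.det_updateRow_add, Matrix.det_updateRow_smul]
      have h4 : 0 ≤ ((row S).updateRow x v).det := by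
        apply Matrix.det_nonneg_of_offDiag_nonpos
        · intro i j hij
          by_cases hi : i = x
          · subst hi
            simp [v, hij, G.transitionMatrix_nonneg hp']
          · simpa [hi] using hrow_off S i j hij
        · intro i
          by_cases hi : i = x
          · subst hi
            simp [v, hsum']
          · simpa [hi] using hrow_sum S i
      have h5 : 0 ≤ ∏ y ∈ S, p (t y) := Finset.prod_nonneg fun y _ => hp0 _
      rw [h3, mul_add]
      have := mul_nonneg h5 h4
      nlinarith
  have := key Finset.univ
  have h6 : row Finset.univ = 1 - G.sectionMatrix t := by ext; simp [row]
  rwa [h6] at this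

/-- The central estimate: it makes I - P_U invertible and also bounds the ratio inside the
expectation by 1. -/
theorem prod_section_le_det {p : E → ℝ} (hp : p ∈ G.environments) {t : U → E}
    (ht : ∀ x, G.tail (t x) = x) (hcyc : ¬ G.ContainsCycle (Set.range t)) :
    ∏ x, p (t x) ≤ (1 - G.transitionMatrix p).det := by
  simpa [G.det_one_sub_sectionMatrix ht hcyc] using G.prod_mul_det_le hp ht

theorem det_pos {p : E → ℝ} (hp : p ∈ G.environments) {t : U → E}
    (ht : ∀ x, G.tail (t x) = x) (hcyc : ¬ G.ContainsCycle (Set.range t)) :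
    0 < (1 - G.transitionMatrix p).det :=
  (Finset.prod_pos fun _ _ => (hp.1 _).1).trans_le (G.prod_section_le_det hp ht hcyc)

/-! ### The Green function -/

theorem pow_transitionMatrix_nonneg {p : E → ℝ} (hp : ∀ e, 0 ≤ p e) (n : ℕ) (x y : U) :
    0 ≤ (G.transitionMatrix p ^ n) x y := by
  induction n generalizing x y with
  | zero => simp only [pow_zero, Matrix.one_apply]; split_ifs <;> simp
  | succ n ih =>
    rw [pow_succ, Matrix.mul_apply]
    exact Finset.sum_nonneg fun z _ => mul_nonneg (ih _ _) (G.transitionMatrix_nonneg hp _ _)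

theorem sum_pow_transitionMatrix_le {p : E → ℝ} (hp : p ∈ G.environments) (n : ℕ) (x : U) :
    ∑ y, (G.transitionMatrix p ^ n) x y ≤ 1 := by
  have hp0 : ∀ e, 0 ≤ p e := fun e => (hp.1 e).1.le
  induction n with
  | zero => simp [Matrix.one_apply]
  | succ n ih =>
    simp only [pow_succ, Matrix.mul_apply]
    rw [Finset.sum_comm]
    refine le_trans (Finset.sum_le_sum fun z _ => ?_) ih
    rw [← Finset.mul_sum]
    have := (G.sum_transitionMatrix_le hp0 z).trans_eq (hp.2 z)
    exact mul_le_of_le_one_right (G.pow_transitionMatrix_nonneg hp0 _ _ _) this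

theorem pow_transitionMatrix_le_one {p : E → ℝ} (hp : p ∈ G.environments) (n : ℕ) (x y : U) :
    (G.transitionMatrix p ^ n) x y ≤ 1 :=
  (Finset.single_le_sum (f := fun y => (G.transitionMatrix p ^ n) x y)
    (fun z _ => G.pow_transitionMatrix_nonneg (fun e => (hp.1 e).1.le) n x z)
    (Finset.mem_univ y)).trans (G.sum_pow_transitionMatrix_le hp n x)

/-- Partial sums of the Neumann series equal (1 - P^N)G. The entries of P^N lie in [0, 1], so these
sums are bounded and, having nonnegative terms, converge. Then P^N tends to 0 and the remainder P^N
G disappears; no estimate of the spectral radius is needed. -/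
theorem hasSum_green {p : E → ℝ} (hp : p ∈ G.environments)
    (hdet : (1 - G.transitionMatrix p).det ≠ 0) (x y : U) :
    HasSum (fun n => (G.transitionMatrix p ^ n) x y) (G.green p x y) := by
  have hp0 : ∀ e, 0 ≤ p e := fun e => (hp.1 e).1.le
  have hpartial : ∀ (N : ℕ) (x y : U), ∑ n ∈ Finset.range N, (G.transitionMatrix p ^ n) x y
      = G.green p x y - ∑ z, (G.transitionMatrix p ^ N) x z * G.green p z y := by
    intro N x y
    have h1 : ∑ n ∈ Finset.range N, G.transitionMatrix p ^ n
        = (1 - G.transitionMatrix p ^ N) * G.green p := by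
      rw [← geom_sum_mul_neg, Matrix.mul_assoc, green, Matrix.mul_nonsing_inv _ (Ne.isUnit hdet),
        Matrix.mul_one]
    have h2 := congrFun (congrFun h1 x) y
    rwa [Matrix.sum_apply, Matrix.sub_mul, Matrix.one_mul, Matrix.sub_apply,
      Matrix.mul_apply] at h2
  have hsum : ∀ x y, Summable fun n => (G.transitionMatrix p ^ n) x y := by
    intro x y
    refine summable_of_sum_range_le (c := |G.green p x y| + ∑ z, |G.green p z y|)
      (fun n => G.pow_transitionMatrix_nonneg hp0 n x y) fun N => ?_
    rw [hpartial]
    refine sub_le_iff_le_add.mpr ((le_abs_self _).trans ?_)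
    have : -∑ z, |G.green p z y| ≤ ∑ z, (G.transitionMatrix p ^ N) x z * G.green p z y := by
      rw [← Finset.sum_neg_distrib]
      refine Finset.sum_le_sum fun z _ => ?_
      rw [neg_le]
      refine (neg_le_abs _).trans ?_
      rw [abs_mul, abs_of_nonneg (G.pow_transitionMatrix_nonneg hp0 N x z)]
      exact mul_le_of_le_one_left (abs_nonneg _) (G.pow_transitionMatrix_le_one hp N x z)
    linarith
  have hlim := (hsum x y).hasSum.tendsto_sum_nat
  have hlim' : Filter.Tendsto (fun N => ∑ n ∈ Finset.range N, (G.transitionMatrix p ^ n) x y)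
      Filter.atTop (nhds (G.green p x y - ∑ z, 0 * G.green p z y)) := by
    simp only [hpartial]
    refine tendsto_const_nhds.sub (tendsto_finsetSum _ fun z _ => ?_)
    exact ((hsum x z).tendsto_atTop_zero).mul_const _
  have := tendsto_nhds_unique hlim hlim'
  simp only [zero_mul, Finset.sum_const_zero, sub_zero] at this
  exact this ▸ (hsum x y).hasSum

theorem green_nonneg {p : E → ℝ} (hp : p ∈ G.environments)
    (hdet : (1 - G.transitionMatrix p).det ≠ 0) (x y : U) : 0 ≤ G.green p x y :=
  (G.hasSum_green hp hdet x y).nonneg fun n =>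
    G.pow_transitionMatrix_nonneg (fun e => (hp.1 e).1.le) n x y

theorem step_tail_head (p : E → ℝ) (e : E) : G.step p (some (G.tail e)) (G.head e) = p e := by
  have : (Finset.univ.filter fun f => G.tail f = G.tail e ∧ G.head f = G.head e) = {e} := by
    ext f
    simp only [Finset.mem_filter, Finset.mem_univ, true_and, Finset.mem_singleton]
    exact ⟨fun h => G.simple _ _ h.1 h.2, fun h => by simp [h]⟩
  simp only [step, this, Finset.sum_singleton]

/-- A directed path of length k from x₀ to x makes the entry of P^k positive, and this is one term
of the Neumann series. Its intermediate vertices lie in U because each is the origin of an edge. -/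
theorem green_pos {p : E → ℝ} (hp : p ∈ G.environments)
    (hdet : (1 - G.transitionMatrix p).det ≠ 0) {x₀ : U} (hG : G.IsAdmissible x₀) (x : U) :
    0 < G.green p x₀ x := by
  have hp0 : ∀ e, 0 ≤ p e := fun e => (hp.1 e).1.le
  suffices h : ∃ n, 0 < (G.transitionMatrix p ^ n) x₀ x by
    obtain ⟨n, hn⟩ := h
    exact hn.trans_le (le_hasSum (G.hasSum_green hp hdet x₀ x) n fun m _ =>
      G.pow_transitionMatrix_nonneg hp0 m x₀ x)
  by_cases hx : x = x₀
  · exact ⟨0, by simp [hx]⟩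
  obtain ⟨k, v, e, -, h0, hlast, -, harc⟩ := hG.fromBase x hx
  refine ⟨k, ?_⟩
  have key : ∀ (j : Fin (k + 1)) (y : U), v j = some y →
      0 < (G.transitionMatrix p ^ (j : ℕ)) x₀ y := by
    intro j
    induction j using Fin.induction with
    | zero =>
      intro y hy
      rw [h0, Option.some.injEq] at hy
      simp [hy]
    | succ j ih =>
      intro y hy
      obtain ⟨h1, h2⟩ := harc j
      have h3 := ih _ h1.symm
      rw [Fin.val_succ, pow_succ, Matrix.mul_apply]
      refine Finset.sum_pos' (fun z _ => mul_nonneg (G.pow_transitionMatrix_nonneg hp0 _ _ _)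
        (G.transitionMatrix_nonneg hp0 _ _)) ⟨G.tail (e j), Finset.mem_univ _, mul_pos h3 ?_⟩
      have h4 : G.transitionMatrix p (G.tail (e j)) y = p (e j) := by
        rw [← G.step_tail_head p (e j), h2, hy]; rfl
      exact h4 ▸ (hp.1 _).1
  simpa using key (Fin.last k) x hlast

theorem occupation_pos {p : E → ℝ} (hp : p ∈ G.environments)
    (hdet : (1 - G.transitionMatrix p).det ≠ 0) {x₀ : U} (hG : G.IsAdmissible x₀) (e : E) :
    0 < G.occupation x₀ p e :=
  mul_pos (G.green_pos hp hdet hG _) (hp.1 e).1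

/-! ### Expected number of crossings -/

theorem step_nonneg {p : E → ℝ} (hp : ∀ e, 0 ≤ p e) (a b : Option U) : 0 ≤ G.step p a b := by
  cases a with
  | none => simp only [step]; split_ifs <;> simp
  | some x => exact Finset.sum_nonneg fun e _ => hp e

variable {G} in
theorem IsMarkovChain.measurableSet_crossing {x₀ : U} {p : E → ℝ} {Ω : Type*} [MeasurableSpace Ω]
    {ℙ : Measure Ω} {X : ℕ → Ω → Option U} (hX : G.IsMarkovChain x₀ p ℙ X)
    (k : ℕ) (a b : Option U) :
    MeasurableSet {ω | (∀ j ≤ k, X j ω ≠ none) ∧ X k ω = a ∧ X (k + 1) ω = b} := by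
  simp only [Set.ofPred_and, Set.ofPred_forall]
  exact (MeasurableSet.iInter fun j => MeasurableSet.iInter fun _ =>
    (hX.measurable j none).compl).inter ((hX.measurable _ _).inter (hX.measurable _ _))

variable {G} in
-- The law is only given on cylinders, so the event is cut according to the trajectory. Carrying an
-- arbitrary prefix makes the induction on k possible: it is extended by one vertex u, necessarily
-- in U, and summing over u yields P^(k+1) = P P^k.
theorem IsMarkovChain.measure_prefix_crossing {x₀ : U} {p : E → ℝ} (hp : ∀ e, 0 ≤ p e)
    {Ω : Type*} [MeasurableSpace Ω]
    {ℙ : Measure Ω} {X : ℕ → Ω → Option U} (hX : G.IsMarkovChain x₀ p ℙ X) (y : U) (b : Option U)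
    (k n : ℕ) (v : ℕ → Option U) (h0 : v 0 = some x₀) (hv : ∀ i ≤ n, v i ≠ none)
    (x : U) (hx : v n = some x) :
    ℙ {ω | (∀ i ≤ n, X i ω = v i) ∧
        ((∀ j ≤ n + k, X j ω ≠ none) ∧ X (n + k) ω = some y ∧ X (n + k + 1) ω = b)} =
      ENNReal.ofReal ((∏ i ∈ Finset.range n, G.step p (v i) (v (i + 1))) *
        ((G.transitionMatrix p ^ k) x y * G.step p (some y) b)) := by
  induction k generalizing n v x with
  | zero =>
    by_cases hxy : x = y
    · subst hxy
      have hset : {ω | (∀ i ≤ n, X i ω = v i) ∧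
          ((∀ j ≤ n + 0, X j ω ≠ none) ∧ X (n + 0) ω = some x ∧ X (n + 0 + 1) ω = b)} =
          {ω | ∀ i ≤ n + 1, X i ω = Function.update v (n + 1) b i} := by
        ext ω
        simp only [Set.mem_ofPred_eq, add_zero]
        constructor
        · rintro ⟨h1, -, -, h4⟩ i hi
          rcases Nat.le_succ_iff.mp hi with h | h
          · rw [Function.update_of_ne (by omega)]; exact h1 i h
          · subst h; simpa using h4
        · intro h
          have h1 : ∀ i ≤ n, X i ω = v i := fun i hi => by
            rw [h i (by omega), Function.update_of_ne (by omega)]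
          refine ⟨h1, fun j hj => h1 j hj ▸ hv j hj, (h1 n le_rfl).trans hx, ?_⟩
          simpa using h (n + 1) le_rfl
      rw [hset, hX.law, Function.update_of_ne (by omega), if_pos h0, Finset.prod_range_succ]
      congr 2
      · refine Finset.prod_congr rfl fun i hi => ?_
        have := Finset.mem_range.mp hi
        rw [Function.update_of_ne (by omega), Function.update_of_ne (by omega)]
      · rw [Function.update_of_ne (by omega), hx]
        simp
    · have hset : {ω | (∀ i ≤ n, X i ω = v i) ∧
          ((∀ j ≤ n + 0, X j ω ≠ none) ∧ X (n + 0) ω = some y ∧ X (n + 0 + 1) ω = b)} = ∅ := by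
        ext ω
        simp only [Set.mem_ofPred_eq, add_zero, Set.mem_empty_iff_false, iff_false]
        rintro ⟨h1, -, h3, -⟩
        rw [h1 n le_rfl, hx, Option.some.injEq] at h3
        exact hxy h3
      rw [hset]
      simp [Matrix.one_apply_ne hxy]
  | succ k ih =>
    let w : U → ℕ → Option U := fun u => Function.update v (n + 1) (some u)
    have hw : ∀ u i, i ≤ n → w u i = v i := fun u i hi => Function.update_of_ne (by omega) _ _
    have hw' : ∀ u, w u (n + 1) = some u := fun u => Function.update_self _ _ _
    have hwle : ∀ u ω, (∀ i ≤ n + 1, X i ω = w u i) ↔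
        (∀ i ≤ n, X i ω = v i) ∧ X (n + 1) ω = some u := by
      intro u ω
      constructor
      · intro h
        exact ⟨fun i hi => (h i (by omega)).trans (hw u i hi), (h _ le_rfl).trans (hw' u)⟩
      · rintro ⟨h1, h2⟩ i hi
        rcases Nat.le_succ_iff.mp hi with h | h
        · exact (h1 i h).trans (hw u i h).symm
        · subst h; exact h2.trans (hw' u).symm
    have hset : {ω | (∀ i ≤ n, X i ω = v i) ∧ ((∀ j ≤ n + (k + 1), X j ω ≠ none) ∧
          X (n + (k + 1)) ω = some y ∧ X (n + (k + 1) + 1) ω = b)} =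
        ⋃ u : U, {ω | (∀ i ≤ n + 1, X i ω = w u i) ∧ ((∀ j ≤ n + 1 + k, X j ω ≠ none) ∧
          X (n + 1 + k) ω = some y ∧ X (n + 1 + k + 1) ω = b)} := by
      ext ω
      simp only [Set.mem_ofPred_eq, Set.mem_iUnion, hwle, show n + (k + 1) = n + 1 + k by omega]
      constructor
      · rintro ⟨h1, h2, h3⟩
        obtain ⟨u, hu⟩ := Option.ne_none_iff_exists'.mp (h2 (n + 1) (by omega))
        exact ⟨u, ⟨h1, hu⟩, h2, h3⟩
      · rintro ⟨u, ⟨h1, hu⟩, h2, h3⟩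
        exact ⟨h1, h2, h3⟩
    rw [hset, measure_iUnion, tsum_fintype]
    · have hih : ∀ u, ℙ {ω | (∀ i ≤ n + 1, X i ω = w u i) ∧ ((∀ j ≤ n + 1 + k, X j ω ≠ none) ∧
          X (n + 1 + k) ω = some y ∧ X (n + 1 + k + 1) ω = b)} =
          ENNReal.ofReal ((∏ i ∈ Finset.range n, G.step p (v i) (v (i + 1))) *
            G.transitionMatrix p x u *
            ((G.transitionMatrix p ^ k) u y * G.step p (some y) b)) := by
        intro u
        rw [ih (n + 1) (w u) ((hw u 0 (by omega)).trans h0) _ u (hw' u), Finset.prod_range_succ,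
          hw', hw u n le_rfl, hx]
        · congr 3
          refine Finset.prod_congr rfl fun i hi => ?_
          have := Finset.mem_range.mp hi
          rw [hw u i (by omega), hw u (i + 1) (by omega)]
        · intro i hi
          rcases Nat.le_succ_iff.mp hi with h | h
          · rw [hw u i h]; exact hv i h
          · subst h; simp [hw']
      have hstep := G.step_nonneg hp
      simp only [hih]
      rw [← ENNReal.ofReal_sum_of_nonneg]
      · congr 1
        rw [pow_succ', Matrix.mul_apply, Finset.sum_mul, Finset.mul_sum]
        refine Finset.sum_congr rfl fun u _ => ?_
        ring
      · intro u _
        exact mul_nonneg (mul_nonneg (Finset.prod_nonneg fun i _ => hstep _ _)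
          (G.transitionMatrix_nonneg hp _ _))
          (mul_nonneg (G.pow_transitionMatrix_nonneg hp _ _ _) (hstep _ _))
    · intro u u' huu'
      refine Set.disjoint_left.mpr fun ω h h' => huu' ?_
      have h1 := ((hwle u ω).mp h.1).2
      have h2 := ((hwle u' ω).mp h'.1).2
      exact Option.some.inj (h1.symm.trans h2)
    · intro u
      rw [Set.ofPred_and]
      refine MeasurableSet.inter ?_ (hX.measurableSet_crossing _ _ _)
      simp only [Set.ofPred_forall]
      exact MeasurableSet.iInter fun i => MeasurableSet.iInter fun _ => hX.measurable _ _

variable {G} in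
theorem IsMarkovChain.measure_crossing {x₀ : U} {p : E → ℝ} (hp : ∀ e, 0 ≤ p e)
    {Ω : Type*} [MeasurableSpace Ω] {ℙ : Measure Ω} {X : ℕ → Ω → Option U}
    (hX : G.IsMarkovChain x₀ p ℙ X) (e : E) (k : ℕ) :
    ℙ {ω | (∀ j ≤ k, X j ω ≠ none) ∧ X k ω = some (G.tail e) ∧ X (k + 1) ω = G.head e} =
      ENNReal.ofReal ((G.transitionMatrix p ^ k) x₀ (G.tail e) * p e) := by
  have h1 := hX.measure_prefix_crossing hp (G.tail e) (G.head e) k 0 (fun _ => some x₀) rfl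
    (by simp) x₀ rfl
  simp only [Finset.range_zero, Finset.prod_empty, one_mul, G.step_tail_head, zero_add] at h1
  rw [← h1]
  refine measure_congr ?_
  -- The prefix of length zero only says X₀ = x₀, which holds almost surely by the law at time 0 and
  -- can be dropped.
  have hnull : ∀ b : Option U, b ≠ some x₀ → ℙ {ω | X 0 ω = b} = 0 := by
    intro b hb
    have := hX.law 0 (fun _ => b)
    simpa [hb] using this
  have hae : ∀ᵐ ω ∂ℙ, X 0 ω = some x₀ := by
    rw [ae_iff]
    have : {ω | ¬ X 0 ω = some x₀} ⊆ ⋃ b : {b : Option U // b ≠ some x₀}, {ω | X 0 ω = b} := by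
      intro ω hω
      exact Set.mem_iUnion.mpr ⟨⟨X 0 ω, hω⟩, rfl⟩
    exact measure_mono_null this (measure_iUnion_null fun b => hnull b b.2)
  filter_upwards [hae] with ω hω
  apply propext
  change (_ ↔ _ ∧ _)
  refine ⟨fun h => ⟨fun i hi => ?_, h⟩, fun h => h.2⟩
  rw [Nat.le_zero.mp hi, hω]

variable {G} in
-- The crossing at time k has probability P^k(x₀, x) p_e with x the origin of e; summing over k
-- gives the Neumann series.
theorem IsMarkovChain.expectedCrossings_eq {x₀ : U} {p : E → ℝ} (hp : p ∈ G.environments)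
    (hdet : (1 - G.transitionMatrix p).det ≠ 0)
    {Ω : Type*} [MeasurableSpace Ω] {ℙ : Measure Ω} {X : ℕ → Ω → Option U}
    (hX : G.IsMarkovChain x₀ p ℙ X) (e : E) :
    G.expectedCrossings ℙ X e = ENNReal.ofReal (G.occupation x₀ p e) := by
  have hp0 : ∀ e, 0 ≤ p e := fun e => (hp.1 e).1.le
  have hsum := (G.hasSum_green hp hdet x₀ (G.tail e)).mul_right (p e)
  have hmeas := fun k => hX.measurableSet_crossing k (some (G.tail e)) (G.head e)
  rw [expectedCrossings, lintegral_tsum fun k =>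
    (measurable_one.indicator (hmeas k)).aemeasurable]
  simp only [lintegral_indicator_one (hmeas _), hX.measure_crossing hp0]
  rw [occupation, ← hsum.tsum_eq, ENNReal.ofReal_tsum_of_nonneg _ hsum.summable]
  exact fun k => mul_nonneg (G.pow_transitionMatrix_nonneg hp0 _ _ _) (hp0 e)

/-! ### Splitting sums at a vertex into the section edge and the others -/

/-- The sum over the edges off `r` with origin `x`. -/
def coordSum {r : U → E} (q : G.Coord r → ℝ) (x : U) : ℝ :=
  ∑ f : G.Coord r, if G.tail f = x then q f else 0

theorem sum_tail_eq {r : U → E} (hr : ∀ x, G.tail (r x) = x) (f : E → ℝ) (x : U) :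
    ∑ e with G.tail e = x, f e = f (r x) + G.coordSum (r := r) (fun e => f e) x := by
  unfold coordSum
  rw [Finset.sum_filter,
    ← Finset.sum_filter_add_sum_filter_not Finset.univ (fun e => e ≠ r (G.tail e)), add_comm]
  congr 1
  · rw [Finset.sum_eq_single (r x)]
    · simp [hr]
    · intro e he hne
      simp only [not_not, Finset.mem_filter, Finset.mem_univ, true_and] at he
      rw [if_neg]
      rintro rfl
      exact hne he
    · simp [hr]
  · exact Finset.sum_subtype _ (by simp) (fun e => if G.tail e = x then f e else 0)

/-! ### Coordinates on the set of environments -/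

/-- The coordinates of an environment off the section `r`. -/
def envCoord (r : U → E) (p : G.environments) (e : G.Coord r) : ℝ := (p : E → ℝ) e

/-- The weights with total mass one at every vertex and given values off the section `r`. -/
def envExtend (r : U → E) (q : G.Coord r → ℝ) (e : E) : ℝ :=
  if h : e ≠ r (G.tail e) then q ⟨e, h⟩ else 1 - G.coordSum q (G.tail e)

theorem environmentVolume_eq (r : U → E) :
    G.environmentVolume r = volume.comap (G.envCoord r) := rfl

theorem envExtend_envCoord {r : U → E} (hr : ∀ x, G.tail (r x) = x) (p : G.environments) :
    G.envExtend r (G.envCoord r p) = p := by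
  ext e
  unfold envExtend
  split_ifs with h
  · rfl
  · have h1 := G.sum_tail_eq hr (p : E → ℝ) (G.tail e)
    rw [p.2.2, ← not_not.mp h] at h1
    rw [h1]
    exact add_sub_cancel_right _ _

theorem measurableSet_environments : MeasurableSet G.environments := by
  have : G.environments = (⋂ e, {p : E → ℝ | 0 < p e} ∩ {p | p e ≤ 1}) ∩
      ⋂ x, {p | ∑ e with G.tail e = x, p e = 1} := by
    ext p
    simp [environments, Set.mem_iInter]
  rw [this]
  refine MeasurableSet.inter (MeasurableSet.iInter fun e => ?_) (MeasurableSet.iInter fun x => ?_)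
  · exact (measurableSet_lt measurable_const (measurable_pi_apply e)).inter
      (measurableSet_le (measurable_pi_apply e) measurable_const)
  · exact measurableSet_eq_fun (by fun_prop) measurable_const

/-- An injective measurable map between standard Borel spaces is an embedding. This is what gives
`Measure.comap` its intended meaning in `environmentVolume`. -/
theorem measurableEmbedding_envCoord {r : U → E} (hr : ∀ x, G.tail (r x) = x) :
    MeasurableEmbedding (G.envCoord r) := by
  have := G.measurableSet_environments.standardBorel
  refine Measurable.measurableEmbedding ?_ ?_
  · refine measurable_pi_lambda _ fun e => ?_
    exact (measurable_pi_apply (e : E)).comp measurable_subtype_coe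
  · intro p p' h
    apply Subtype.ext
    rw [← G.envExtend_envCoord hr p, ← G.envExtend_envCoord hr p', h]

/-! ### Independence of the reference measure from the section -/

/-- The permutation of the edges exchanging `r x` and `s x` for every `x`. -/
def exchange {r s : U → E} (hr : ∀ x, G.tail (r x) = x) (hs : ∀ x, G.tail (s x) = x) :
    Equiv.Perm E :=
  Function.Involutive.toPerm
    (fun e => if e = s (G.tail e) then r (G.tail e) else
      if e = r (G.tail e) then s (G.tail e) else e) (by
    intro e
    by_cases h1 : e = s (G.tail e) <;> by_cases h2 : e = r (G.tail e)
    · simp [← h1, ← h2]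
    · simp only [← h1, if_true, hr]
      split_ifs with h3
      · exact h3
      · rfl
    · simp only [h1, if_false, ← h2, if_true, hs]
    · simp [h1, h2])

theorem tail_exchange {r s : U → E} (hr : ∀ x, G.tail (r x) = x) (hs : ∀ x, G.tail (s x) = x)
    (e : E) : G.tail (G.exchange hr hs e) = G.tail e := by
  change G.tail (if e = s (G.tail e) then r (G.tail e) else
      if e = r (G.tail e) then s (G.tail e) else e) = _
  split_ifs <;> simp [hr, hs]

theorem exchange_section {r s : U → E} (hr : ∀ x, G.tail (r x) = x)
    (hs : ∀ x, G.tail (s x) = x) (x : U) : G.exchange hr hs (r x) = s x := by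
  change (if r x = s (G.tail (r x)) then r (G.tail (r x)) else
      if r x = r (G.tail (r x)) then s (G.tail (r x)) else r x) = _
  simp only [hr, if_true]
  split_ifs with h
  · exact h
  · rfl

/-- The bijection between the edges off `r` and the edges off `s`. -/
def coordEquiv {r s : U → E} (hr : ∀ x, G.tail (r x) = x) (hs : ∀ x, G.tail (s x) = x) :
    G.Coord r ≃ G.Coord s :=
  (G.exchange hr hs).subtypeEquiv fun e => by
    rw [tail_exchange, ← G.exchange_section hr hs, (G.exchange hr hs).injective.ne_iff]

/-- The linear part of the change of coordinates from `r` to `s`. -/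
def exchangeLinear (r s : U → E) : (G.Coord r → ℝ) →ₗ[ℝ] (G.Coord r → ℝ) where
  toFun q e := if (e : E) = s (G.tail e) then -G.coordSum q (G.tail e)
    else q e
  map_add' q q' := by
    ext e
    simp only [Pi.add_apply]
    split_ifs
    · rw [coordSum, coordSum, coordSum, ← neg_add, ← Finset.sum_add_distrib]
      congr 1
      refine Finset.sum_congr rfl fun f _ => ?_
      split_ifs <;> simp
    · rfl
  map_smul' c q := by
    ext e
    simp only [Pi.smul_apply, smul_eq_mul, RingHom.id_apply]
    split_ifs
    · rw [coordSum, coordSum, mul_neg, Finset.mul_sum]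
      congr 1
      refine Finset.sum_congr rfl fun f _ => ?_
      split_ifs <;> simp
    · rfl

/-- The linear map is an involution, so its determinant squares to 1. Exchanging a coordinate for
minus the sum at its vertex twice restores it. -/
theorem abs_det_exchangeLinear (r s : U → E) :
    |LinearMap.det (G.exchangeLinear r s)| = 1 := by
  have hinv : G.exchangeLinear r s ∘ₗ G.exchangeLinear r s = LinearMap.id := by
    refine LinearMap.ext fun w => funext fun e => ?_
    simp only [LinearMap.comp_apply, LinearMap.id_apply]
    by_cases he : (e : E) = s (G.tail e)
    · have h1 : G.coordSum (G.exchangeLinear r s w) (G.tail e)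
          = G.coordSum w (G.tail e) + (-G.coordSum w (G.tail e) - w e) := by
        -- The map alters only the coordinate `e` among those at this vertex, so the new sum differs
        -- from the old one by a single term.
        have h2 : -G.coordSum w (G.tail e) - w e
            = ∑ f : G.Coord r, if f = e then -G.coordSum w (G.tail e) - w e else 0 := by simp
        rw [h2]
        conv_lhs => rw [coordSum]
        nth_rewrite 1 [coordSum]
        rw [← Finset.sum_add_distrib]
        refine Finset.sum_congr rfl fun f _ => ?_
        change (if G.tail f = G.tail e then
          (if (f : E) = s (G.tail f) then -G.coordSum w (G.tail f) else w f) else 0) = _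
        by_cases hf : f = e
        · subst hf
          simp [← he]
        · by_cases hx : G.tail f = G.tail e
          · have : (f : E) ≠ s (G.tail f) := fun h => hf (Subtype.ext (by rw [h, hx, ← he]))
            rw [if_pos hx, if_neg this, if_pos hx, if_neg hf, add_zero]
          · rw [if_neg hx, if_neg hx, if_neg hf, add_zero]
      change (if (e : E) = s (G.tail e) then
        -G.coordSum (G.exchangeLinear r s w) (G.tail e) else _) = _
      rw [if_pos he, h1]
      ring
    · change (if (e : E) = s (G.tail e) then _ else
        (if (e : E) = s (G.tail e) then _ else w e)) = _
      rw [if_neg he, if_neg he]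
  have hdet : LinearMap.det (G.exchangeLinear r s) * LinearMap.det (G.exchangeLinear r s) = 1 := by
    rw [← LinearMap.det_comp, hinv, LinearMap.det_id]
  have : |LinearMap.det (G.exchangeLinear r s)| * |LinearMap.det (G.exchangeLinear r s)| = 1 := by
    rw [← abs_mul, hdet, abs_one]
  nlinarith [abs_nonneg (LinearMap.det (G.exchangeLinear r s))]

/-- Where r and s differ at x, the coordinate p_{s x} is replaced by p_{r x}, which is 1 minus the
sum of the coordinates off r at x. The change of coordinates is thus affine up to relabelling. -/
theorem envCoord_eq_exchange {r s : U → E} (hr : ∀ x, G.tail (r x) = x)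
    (hs : ∀ x, G.tail (s x) = x) (p : G.environments) :
    G.envCoord s p = MeasurableEquiv.arrowCongr' (G.coordEquiv hr hs) (MeasurableEquiv.refl ℝ)
      ((fun e : G.Coord r => if (e : E) = s (G.tail e) then (1 : ℝ) else 0) +
        G.exchangeLinear r s (G.envCoord r p)) := by
  ext f
  obtain ⟨e, rfl⟩ := (G.coordEquiv hr hs).surjective f
  have h1 : G.envCoord s p (G.coordEquiv hr hs e) = (p : E → ℝ) (G.exchange hr hs e) := rfl
  have h2 : G.exchange hr hs e = if (e : E) = s (G.tail e) then r (G.tail e) else e := by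
    change (if (e : E) = s (G.tail e) then r (G.tail e) else
      if (e : E) = r (G.tail e) then s (G.tail e) else e) = _
    rw [if_neg e.2]
  have h3 := G.sum_tail_eq hr (p : E → ℝ) (G.tail e)
  rw [p.2.2] at h3
  rw [h1, h2]
  simp only [MeasurableEquiv.arrowCongr', MeasurableEquiv.coe_mk, Equiv.arrowCongr', Equiv.arrowCongr,
    Equiv.coe_fn_mk, Function.comp_apply, Equiv.symm_apply_apply, Pi.add_apply]
  change _ = (if (e : E) = s (G.tail e) then (1 : ℝ) else 0) +
    (if (e : E) = s (G.tail e) then -G.coordSum (G.envCoord r p) (G.tail e)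
      else G.envCoord r p e)
  split_ifs with h
  · rw [h3]
    exact (add_neg_cancel_right _ _).symm
  · simp [envCoord]

theorem environmentVolume_congr {r s : U → E} (hr : ∀ x, G.tail (r x) = x)
    (hs : ∀ x, G.tail (s x) = x) : G.environmentVolume r = G.environmentVolume s := by
  ext S hS
  rw [environmentVolume_eq, environmentVolume_eq, (G.measurableEmbedding_envCoord hr).comap_apply,
    (G.measurableEmbedding_envCoord hs).comap_apply]
  set e := MeasurableEquiv.arrowCongr' (G.coordEquiv hr hs) (MeasurableEquiv.refl ℝ) with he
  set c : G.Coord r → ℝ := fun e => if (e : E) = s (G.tail e) then (1 : ℝ) else 0 with hc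
  have himage : G.envCoord s '' S =
      e '' ((fun v => c + v) '' (G.exchangeLinear r s '' (G.envCoord r '' S))) := by
    simp only [Set.image_image]
    exact Set.image_congr fun p _ => G.envCoord_eq_exchange hr hs p
  have hpres : MeasurePreserving e :=
    volume_preserving_arrowCongr' _ _ (MeasurePreserving.id volume)
  rw [himage, e.image_eq_preimage_symm, (hpres.symm).measure_preimage_equiv, Set.image_add_left,
    measure_preimage_add, Measure.addHaar_image_linearMap, G.abs_det_exchangeLinear r s]
  simp

/-! ### Finiteness of the Dirichlet law -/

theorem prod_section {s : U → E} (hs : ∀ x, G.tail (s x) = x) (f : E → ℝ) :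
    ∏ e with e = s (G.tail e), f e = ∏ x, f (s x) := by
  exact Finset.prod_nbij' G.tail s (by simp) (by simp [hs])
    (fun e he => (Finset.mem_filter.mp he).2.symm) (fun x _ => hs x)
    (fun e he => congrArg f (Finset.mem_filter.mp he).2)

theorem prod_eq_prod_section_mul {s : U → E} (hs : ∀ x, G.tail (s x) = x) (f : E → ℝ) :
    ∏ e, f e = (∏ x, f (s x)) * ∏ e : G.Coord s, f e := by
  rw [← Finset.prod_filter_mul_prod_filter_not Finset.univ (fun e => e = s (G.tail e)),
    G.prod_section hs]
  congr 1
  exact Finset.prod_subtype _ (by simp) f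

theorem integrable_prod_rpow {ι : Type*} [Fintype ι] (a : ι → ℝ) (ha : ∀ i, 0 < a i) :
    Integrable fun q : ι → ℝ =>
      ∏ i, (Set.Ioc (0 : ℝ) 1).indicator (fun u => u ^ (a i - 1)) (q i) := by
  refine Integrable.fintype_prod
    (f := fun i => (Set.Ioc (0 : ℝ) 1).indicator (fun u => u ^ (a i - 1))) fun i => ?_
  rw [integrable_indicator_iff measurableSet_Ioc,
    ← intervalIntegrable_iff_integrableOn_Ioc_of_le zero_le_one]
  exact intervalIntegral.intervalIntegrable_rpow' (by linarith [ha i])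

/-- One bound covers both signs of the exponent. -/
theorem rpow_le_of_mem_Icc {c u : ℝ} (hc : 0 < c) (hcu : c ≤ u) (hu : u ≤ 1) (a : ℝ) :
    u ^ a ≤ c ^ (-|a|) :=
  (Real.rpow_le_rpow_of_exponent_ge (hc.trans_le hcu) hu (neg_abs_le a)).trans
    (Real.rpow_le_rpow_of_nonpos hc hcu (neg_nonpos.mpr (abs_nonneg a)))

/-- At each vertex the exit probabilities sum to 1 over at most |E| edges, so one of them is at
least 1/|E|. -/
theorem exists_section_le {p : E → ℝ} (hp : p ∈ G.environments) :
    ∃ s : U → E, (∀ x, G.tail (s x) = x) ∧ ∀ x, (Fintype.card E : ℝ)⁻¹ ≤ p (s x) := by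
  have key : ∀ x, ∃ e ∈ Finset.univ.filter (fun e => G.tail e = x),
      (Fintype.card E : ℝ)⁻¹ ≤ p e := by
    intro x
    have hne : (Finset.univ.filter (fun e => G.tail e = x)).Nonempty := by
      by_contra h
      have h1 := hp.2 x
      rw [Finset.not_nonempty_iff_eq_empty.mp h] at h1
      simp at h1
    refine Finset.exists_le_of_sum_le hne ?_
    rw [hp.2 x, Finset.sum_const, nsmul_eq_mul]
    exact mul_inv_le_one_of_le₀ (by exact_mod_cast Finset.card_le_univ _) (by positivity)
  choose s hs using key
  exact ⟨s, fun x => (Finset.mem_filter.mp (hs x).1).2, fun x => (hs x).2⟩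

theorem measurable_env_apply (e : E) : Measurable fun p : G.environments => (p : E → ℝ) e :=
  (measurable_pi_apply e).comp measurable_subtype_coe

/-- In fixed coordinates the dependent factors p_{r x} may be singular too. The environments are
therefore covered by finitely many sets on which some section s satisfies p_{s x} ≥ 1/|E|. There, in
coordinates off s, the dependent factors are bounded and the others form an integrable product of
powers on (0, 1]. -/
theorem integrable_dirichletDensity {r : U → E} (hr : ∀ x, G.tail (r x) = x)
    {α : E → ℝ} (hα : ∀ e, 0 < α e) :
    Integrable (fun p : G.environments => ∏ e, (p : E → ℝ) e ^ (α e - 1))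
      (G.environmentVolume r) := by
  set N : ℝ := (Fintype.card E : ℝ)⁻¹ with hN
  let A : {s : U → E // ∀ x, G.tail (s x) = x} → Set G.environments := fun s =>
    {p | ∀ x, N ≤ (p : E → ℝ) (s.1 x)}
  have hmeas : Measurable fun p : G.environments => ∏ e, (p : E → ℝ) e ^ (α e - 1) :=
    Finset.measurable_prod _ fun e _ => (G.measurable_env_apply e).pow_const _
  have hA : ∀ s, MeasurableSet (A s) := by
    intro s
    simp only [A, Set.ofPred_forall]
    exact MeasurableSet.iInter fun x => measurableSet_le measurable_const (G.measurable_env_apply _)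
  have hcover : ⋃ s, A s = Set.univ := by
    refine Set.eq_univ_of_forall fun p => ?_
    obtain ⟨s, hs, hle⟩ := G.exists_section_le p.2
    exact Set.mem_iUnion.mpr ⟨⟨s, hs⟩, hle⟩
  rw [← integrableOn_univ, ← hcover, integrableOn_finite_iUnion]
  rintro ⟨s, hs⟩
  rw [G.environmentVolume_congr hr hs]
  have hemb := G.measurableEmbedding_envCoord hs
  have hint : Integrable (fun p : G.environments => ∏ e : G.Coord s,
      (Set.Ioc (0 : ℝ) 1).indicator (fun u => u ^ (α e - 1)) (G.envCoord s p e))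
      (G.environmentVolume s) := by
    have h1 := (integrable_prod_rpow (fun e : G.Coord s => α e) fun e => hα e).restrict
      (s := Set.range (G.envCoord s))
    rw [← hemb.map_comap, hemb.integrable_map_iff] at h1
    exact h1
  refine Integrable.mono' (hint.const_mul (∏ x, N ^ (-|α (s x) - 1|))).integrableOn
    hmeas.aestronglyMeasurable ?_
  refine (ae_restrict_iff' (hA _)).mpr (Filter.Eventually.of_forall fun p hp => ?_)
  have hp0 : ∀ e, 0 < (p : E → ℝ) e := fun e => (p.2.1 e).1
  have hpow : ∀ e, 0 ≤ (p : E → ℝ) e ^ (α e - 1) := fun e => Real.rpow_nonneg (hp0 e).le _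
  have hind : ∀ e : G.Coord s, (Set.Ioc (0 : ℝ) 1).indicator (fun u => u ^ (α e - 1))
      (G.envCoord s p e) = (p : E → ℝ) e ^ (α e - 1) := fun e =>
    Set.indicator_of_mem (s := Set.Ioc (0 : ℝ) 1) (p.2.1 e) _
  simp only [hind]
  rw [Real.norm_of_nonneg (Finset.prod_nonneg fun e _ => hpow e),
    G.prod_eq_prod_section_mul hs fun e => (p : E → ℝ) e ^ (α e - 1)]
  refine mul_le_mul_of_nonneg_right ?_ (Finset.prod_nonneg fun e _ => hpow e)
  refine Finset.prod_le_prod (fun x _ => hpow _) fun x _ => ?_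
  have hNpos : 0 < N := by
    have : Nonempty E := ⟨s x⟩
    exact inv_pos.mpr (by exact_mod_cast Fintype.card_pos)
  exact rpow_le_of_mem_Icc hNpos (hp x) (p.2.1 _).2 _

theorem outWeight_pos {r : U → E} (hr : ∀ x, G.tail (r x) = x)
    {α : E → ℝ} (hα : ∀ e, 0 < α e) (x : U) : 0 < G.outWeight α x :=
  Finset.sum_pos (fun e _ => hα e) ⟨r x, by simp [hr]⟩

theorem normConst_pos {r : U → E} (hr : ∀ x, G.tail (r x) = x)
    {α : E → ℝ} (hα : ∀ e, 0 < α e) : 0 < G.normConst α :=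
  div_pos (Finset.prod_pos fun x _ => Real.Gamma_pos_of_pos (G.outWeight_pos hr hα x))
    (Finset.prod_pos fun e _ => Real.Gamma_pos_of_pos (hα e))

theorem isFiniteMeasure_dirichletLaw {r : U → E} (hr : ∀ x, G.tail (r x) = x)
    {α : E → ℝ} (hα : ∀ e, 0 < α e) : IsFiniteMeasure (G.dirichletLaw r α) :=
  isFiniteMeasure_withDensity_ofReal
    ((G.integrable_dirichletDensity hr hα).const_mul (G.normConst α)).2

/-! ### Integrability of the Laplace functional -/

/-- The random variable whose expectation is computed. -/
def laplaceFunctional (x₀ : U) (T : Finset E) (l : E → ℂ) (p : E → ℝ) : ℂ :=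
  Complex.exp (-∑ e, l e * (G.occupation x₀ p e : ℂ)) *
    (((∏ e ∈ T, p e) / (1 - G.transitionMatrix p).det : ℝ) : ℂ)

theorem continuous_transitionMatrix : Continuous G.transitionMatrix := by
  refine continuous_matrix fun x y => ?_
  simp only [transitionMatrix_apply]
  fun_prop

theorem continuous_laplaceFunctional (hdet : ∀ p ∈ G.environments, (1 - G.transitionMatrix p).det ≠ 0)
    (x₀ : U) (T : Finset E) (l : E → ℂ) :
    Continuous fun p : G.environments => G.laplaceFunctional x₀ T l p := by
  have hc : Continuous fun p : G.environments => 1 - G.transitionMatrix (p : E → ℝ) :=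
    continuous_const.sub (G.continuous_transitionMatrix.comp continuous_subtype_val)
  have hd : Continuous fun p : G.environments => (1 - G.transitionMatrix (p : E → ℝ)).det :=
    hc.matrix_det
  have hg : Continuous fun p : G.environments => G.green (p : E → ℝ) := by
    simp only [green, Matrix.inv_def, Ring.inverse_eq_inv']
    exact (hd.inv₀ fun p => hdet p p.2).smul hc.matrix_adjugate
  have he : ∀ e, Continuous fun p : G.environments => (p : E → ℝ) e := fun e =>
    (continuous_apply e).comp continuous_subtype_val
  have ho : ∀ e, Continuous fun p : G.environments => G.occupation x₀ (p : E → ℝ) e := fun e =>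
    (hg.matrix_elem _ _).mul (he e)
  unfold laplaceFunctional
  refine Continuous.mul (Complex.continuous_exp.comp (continuous_finsetSum _ fun e _ => ?_).neg) ?_
  · exact continuous_const.mul (Complex.continuous_ofReal.comp (ho e))
  · refine Complex.continuous_ofReal.comp (Continuous.div ?_ hd fun p => hdet p p.2)
    exact continuous_finsetProd _ fun e _ => he e

/-- Occupations are nonnegative and Re λ > 0, so the exponential has modulus at most 1; the ratio is
at most 1 by `prod_section_le_det`. -/
theorem norm_laplaceFunctional_le_one {p : E → ℝ} (hp : p ∈ G.environments)
    {t : U → E} (ht : ∀ x, G.tail (t x) = x) (hcyc : ¬ G.ContainsCycle (Set.range t))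
    (x₀ : U) {T : Finset E} (hT : ∀ e, e ∈ T ↔ e = t (G.tail e)) {l : E → ℂ}
    (hl : ∀ e, 0 < (l e).re) : ‖G.laplaceFunctional x₀ T l p‖ ≤ 1 := by
  have hdet := G.det_pos hp ht hcyc
  rw [laplaceFunctional, norm_mul, Complex.norm_exp, Complex.norm_real]
  refine mul_le_one₀ (Real.exp_le_one_iff.mpr ?_) (norm_nonneg _) ?_
  · simp only [Complex.neg_re, Complex.re_sum, Complex.re_mul_ofReal, neg_nonpos]
    exact Finset.sum_nonneg fun e _ => mul_nonneg (hl e).le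
      (mul_nonneg (G.green_nonneg hp hdet.ne' _ _) (hp.1 e).1.le)
  · have hTprod : ∏ e ∈ T, p e = ∏ x, p (t x) := by
      rw [← G.prod_section ht]
      exact Finset.prod_congr (by ext; simp [hT]) fun _ _ => rfl
    rw [hTprod, Real.norm_of_nonneg
      (div_nonneg (Finset.prod_nonneg fun x _ => (hp.1 _).1.le) hdet.le)]
    exact div_le_one_of_le₀ (G.prod_section_le_det hp ht hcyc) hdet.le

theorem integrable_laplaceFunctional {r : U → E} (hr : ∀ x, G.tail (r x) = x)
    {α : E → ℝ} (hα : ∀ e, 0 < α e)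
    {t : U → E} (ht : ∀ x, G.tail (t x) = x) (hcyc : ¬ G.ContainsCycle (Set.range t))
    (x₀ : U) {T : Finset E} (hT : ∀ e, e ∈ T ↔ e = t (G.tail e)) {l : E → ℂ}
    (hl : ∀ e, 0 < (l e).re) :
    Integrable (fun p : G.environments => G.laplaceFunctional x₀ T l p) (G.dirichletLaw r α) := by
  have := G.isFiniteMeasure_dirichletLaw hr hα
  refine Integrable.of_bound (G.continuous_laplaceFunctional
    (fun p hp => (G.det_pos hp ht hcyc).ne') x₀ T l).aestronglyMeasurable 1 ?_
  exact Filter.Eventually.of_forall fun p => G.norm_laplaceFunctional_le_one p.2 ht hcyc x₀ hT hl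

/-! ### Flows on the bipartite graph -/

theorem sum_eq_sum_section_add {s : U → E} (hs : ∀ x, G.tail (s x) = x) (f : E → ℝ) :
    ∑ e, f e = ∑ x, f (s x) + ∑ e : G.Coord s, f e := by
  rw [← Finset.sum_filter_add_sum_filter_not Finset.univ (fun e => e = s (G.tail e))]
  congr 1
  · exact Finset.sum_nbij' G.tail s (by simp) (by simp [hs])
      (fun e he => (Finset.mem_filter.mp he).2.symm) (fun x _ => hs x)
      (fun e he => congrArg f (Finset.mem_filter.mp he).2)
  · exact Finset.sum_subtype _ (by simp) f

theorem hat_tail_inl (e : E) : G.hat.tail (Sum.inl e) = (true, G.tail e) := rfl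

theorem hat_tail_inr (x : U) : G.hat.tail (Sum.inr x) = (false, x) := rfl

theorem hat_head_inl (e : E) :
    G.hat.head (Sum.inl e) = (G.head e).map (fun y => (false, y)) := rfl

theorem hat_head_inr (x : U) : G.hat.head (Sum.inr x) = some (true, x) := rfl

/-- The condition at x₊ identifies z on ê_x with the total flow out of x; the condition at x₋ is
conservation with a unit source at x₀. -/
theorem mem_hat_flowSpace_iff (x₀ : U) (z : E ⊕ U → ℝ) :
    z ∈ G.hat.flowSpace (false, x₀) ↔
      (∀ x, ∑ e with G.tail e = x, z (Sum.inl e) = z (Sum.inr x)) ∧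
      ∀ x, z (Sum.inr x) - ∑ e with G.head e = some x, z (Sum.inl e)
        = (Pi.single x₀ 1 : U → ℝ) x := by
  have htrue : ∀ x, G.hat.divergence z (true, x)
      = ∑ e with G.tail e = x, z (Sum.inl e) - z (Sum.inr x) := by
    intro x
    simp only [divergence, Finset.sum_filter, Fintype.sum_sum_type, hat_tail_inl, hat_tail_inr,
      hat_head_inl, hat_head_inr]
    simp
  have hfalse : ∀ x, G.hat.divergence z (false, x)
      = z (Sum.inr x) - ∑ e with G.head e = some x, z (Sum.inl e) := by
    intro x
    simp only [divergence, Finset.sum_filter, Fintype.sum_sum_type, hat_tail_inl, hat_tail_inr,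
      hat_head_inl, hat_head_inr]
    simp
  change G.hat.divergence z = Pi.single (false, x₀) 1 ↔ _
  constructor
  · intro h
    refine ⟨fun x => ?_, fun x => ?_⟩
    · have h1 := congrFun h (true, x)
      rw [htrue, Pi.single_eq_of_ne (by simp)] at h1
      linarith
    · rw [← hfalse, h]
      simp [Pi.single_apply]
  · rintro ⟨h1, h2⟩
    ext ⟨b, x⟩
    cases b
    · rw [hfalse, h2]
      simp [Pi.single_apply]
    · rw [htrue, h1, Pi.single_eq_of_ne (by simp), sub_self]

/-- The environment associated with a positive flow. -/
def flowEnv (z : E ⊕ U → ℝ) (e : E) : ℝ := z (Sum.inl e) / z (Sum.inr (G.tail e))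

theorem flowEnv_mem {x₀ : U} {z : E ⊕ U → ℝ} (hz : z ∈ G.hat.flowSpace (false, x₀))
    (hpos : ∀ f, 0 < z f) : G.flowEnv z ∈ G.environments := by
  have hz' := (G.mem_hat_flowSpace_iff x₀ z).mp hz
  have hp : ∀ e, 0 < G.flowEnv z e := fun e => div_pos (hpos _) (hpos _)
  have hsum : ∀ x, ∑ e with G.tail e = x, G.flowEnv z e = 1 := by
    intro x
    have : ∑ e with G.tail e = x, G.flowEnv z e
        = ∑ e with G.tail e = x, z (Sum.inl e) / z (Sum.inr x) :=
      Finset.sum_congr rfl fun e he => by rw [flowEnv, (Finset.mem_filter.mp he).2]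
    rw [this, ← Finset.sum_div, hz'.1, div_self (hpos _).ne']
  refine ⟨fun e => ⟨hp e, ?_⟩, hsum⟩
  rw [← hsum (G.tail e)]
  exact Finset.single_le_sum (f := G.flowEnv z) (fun f _ => (hp f).le)
    (Finset.mem_filter.mpr ⟨Finset.mem_univ e, rfl⟩)

theorem sum_head_eq_vecMul (p : E → ℝ) (g : U → ℝ) (y : U) :
    ∑ e with G.head e = some y, g (G.tail e) * p e
      = Matrix.vecMul g (G.transitionMatrix p) y := by
  simp only [Matrix.vecMul, dotProduct, transitionMatrix_apply]
  rw [← Finset.sum_fiberwise (Finset.univ.filter fun e => G.head e = some y) G.tail]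
  refine Finset.sum_congr rfl fun x _ => ?_
  rw [Finset.mul_sum, Finset.filter_filter]
  refine Finset.sum_congr (by ext; simp [and_comm]) fun e he => ?_
  rw [(Finset.mem_filter.mp he).2.1]

/-- With z_ê = g_x p_e, conservation becomes g(I - P) = δ_{x₀}, which is inverted. -/
theorem flow_eq_green {x₀ : U} {z : E ⊕ U → ℝ} (hz : z ∈ G.hat.flowSpace (false, x₀))
    (hpos : ∀ f, 0 < z f) (hdet : (1 - G.transitionMatrix (G.flowEnv z)).det ≠ 0) (x : U) :
    z (Sum.inr x) = G.green (G.flowEnv z) x₀ x := by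
  have hz' := (G.mem_hat_flowSpace_iff x₀ z).mp hz
  set g : U → ℝ := fun x => z (Sum.inr x) with hg
  have h1 : Matrix.vecMul g (1 - G.transitionMatrix (G.flowEnv z)) = Pi.single x₀ 1 := by
    ext y
    rw [Matrix.vecMul_sub, Matrix.vecMul_one, Pi.sub_apply, ← G.sum_head_eq_vecMul, ← hz'.2 y]
    congr 1
    refine Finset.sum_congr rfl fun e _ => ?_
    rw [flowEnv, mul_div_cancel₀ _ (hpos _).ne']
  have h2 : g = Matrix.vecMul (Pi.single x₀ 1) (G.green (G.flowEnv z)) := by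
    rw [← h1, Matrix.vecMul_vecMul, green, Matrix.mul_nonsing_inv _ (Ne.isUnit hdet),
      Matrix.vecMul_one]
  have h3 := congrFun h2 x
  rwa [Matrix.single_one_vecMul] at h3

theorem flow_eq_occupation {x₀ : U} {z : E ⊕ U → ℝ} (hz : z ∈ G.hat.flowSpace (false, x₀))
    (hpos : ∀ f, 0 < z f) (hdet : (1 - G.transitionMatrix (G.flowEnv z)).det ≠ 0) (e : E) :
    z (Sum.inl e) = G.occupation x₀ (G.flowEnv z) e := by
  rw [occupation, ← G.flow_eq_green hz hpos hdet, flowEnv, mul_div_cancel₀ _ (hpos _).ne']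

theorem occupation_mem_flowSpace {p : E → ℝ} (hp : p ∈ G.environments) (x₀ : U)
    (hdet : (1 - G.transitionMatrix p).det ≠ 0) :
    Sum.elim (G.occupation x₀ p) (G.green p x₀) ∈ G.hat.flowSpace (false, x₀) := by
  rw [mem_hat_flowSpace_iff]
  simp only [Sum.elim_inl, Sum.elim_inr]
  refine ⟨fun x => ?_, fun x => ?_⟩
  · have : ∑ e with G.tail e = x, G.occupation x₀ p e
        = ∑ e with G.tail e = x, G.green p x₀ x * p e :=
      Finset.sum_congr rfl fun e he => by rw [occupation, (Finset.mem_filter.mp he).2]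
    rw [this, ← Finset.mul_sum, hp.2, mul_one]
  · have h1 : Matrix.vecMul (G.green p x₀) (1 - G.transitionMatrix p) = Pi.single x₀ 1 := by
      have h2 : G.green p x₀ = Matrix.vecMul (Pi.single x₀ 1) (G.green p) :=
        (Matrix.single_one_vecMul x₀ (G.green p)).symm
      rw [h2, Matrix.vecMul_vecMul, green, Matrix.nonsing_inv_mul _ (Ne.isUnit hdet),
        Matrix.vecMul_one]
    rw [← h1, Matrix.vecMul_sub, Matrix.vecMul_one, Pi.sub_apply, ← G.sum_head_eq_vecMul]
    rfl

/-! ### Affine coordinates on the space of flows -/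

/-- Incidence of the edges off the section `t`, relative to the section. -/
def coordIncidence (t : U → E) : Matrix (G.Coord t) U ℝ :=
  Matrix.of fun e y => (if G.head e = some y then 1 else 0) - G.sectionMatrix t (G.tail e) y

/-- The value on t x is eliminated as the total outflow of x minus the values off t. Each edge off t
then contributes its own head minus the head of the section edge with the same origin. -/
theorem sum_head_eq_vecMul_section {t : U → E} (ht : ∀ x, G.tail (t x) = x) (ζ : E → ℝ) (y : U) :
    ∑ e with G.head e = some y, ζ e
      = Matrix.vecMul (fun e : G.Coord t => ζ e) (G.coordIncidence t) y
        + Matrix.vecMul (fun x => ∑ e with G.tail e = x, ζ e) (G.sectionMatrix t) y := by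
  have h1 : Matrix.vecMul (fun x => ∑ e with G.tail e = x, ζ e) (G.sectionMatrix t) y
      = ∑ x, ζ (t x) * G.sectionMatrix t x y
        + ∑ e : G.Coord t, ζ e * G.sectionMatrix t (G.tail e) y := by
    simp only [Matrix.vecMul, dotProduct]
    have : ∀ x, (∑ e with G.tail e = x, ζ e) * G.sectionMatrix t x y
        = ζ (t x) * G.sectionMatrix t x y + ∑ e : G.Coord t,
          if G.tail e = x then ζ e * G.sectionMatrix t (G.tail e) y else 0 := by
      intro x
      rw [G.sum_tail_eq ht, add_mul, coordSum, Finset.sum_mul]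
      congr 1
      refine Finset.sum_congr rfl fun e _ => ?_
      split_ifs with h
      · rw [h]
      · rw [zero_mul]
    simp only [this]
    rw [Finset.sum_add_distrib]
    congr 1
    rw [Finset.sum_comm]
    refine Finset.sum_congr rfl fun e _ => ?_
    simp
  rw [h1, Finset.sum_filter, G.sum_eq_sum_section_add ht]
  simp only [Matrix.vecMul, dotProduct, coordIncidence, Matrix.of_apply, mul_sub,
    Finset.sum_sub_distrib, mul_ite, mul_one, mul_zero]
  have h2 : ∀ x, ζ (t x) * G.sectionMatrix t x y
      = if G.head (t x) = some y then ζ (t x) else 0 := by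
    intro x
    simp [sectionMatrix]
  simp only [h2]
  ring

/-- The total flow through each vertex, in terms of the flow off the section `t`. -/
def flowMass (x₀ : U) (t : U → E) (w : G.Coord t → ℝ) : U → ℝ :=
  Matrix.vecMul (Pi.single x₀ 1 + Matrix.vecMul w (G.coordIncidence t)) (1 - G.sectionMatrix t)⁻¹

/-- The flow of divergence `δ_{x₀}` with given values off the section `t`. -/
def flowExtend (x₀ : U) (t : U → E) (w : G.Coord t → ℝ) : E ⊕ U → ℝ :=
  Sum.elim (fun e => if h : e ≠ t (G.tail e) then w ⟨e, h⟩ else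
    G.flowMass x₀ t w (G.tail e) - G.coordSum w (G.tail e)) (G.flowMass x₀ t w)

theorem flowExtend_coord (x₀ : U) (t : U → E) (w : G.Coord t → ℝ) (e : G.Coord t) :
    G.flowExtend x₀ t w (Sum.inl e) = w e := dif_pos e.2

theorem flowExtend_section (x₀ : U) {t : U → E} (ht : ∀ x, G.tail (t x) = x)
    (w : G.Coord t → ℝ) (x : U) :
    G.flowExtend x₀ t w (Sum.inl (t x)) = G.flowMass x₀ t w x - G.coordSum w x := by
  simp [flowExtend, ht]

/-- `flowMass` is the solution m of m(I - S) = δ_{x₀} + (incidence of the values off t), which is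
conservation at the vertices x₋. -/
theorem flowExtend_mem (x₀ : U) {t : U → E} (ht : ∀ x, G.tail (t x) = x)
    (hdet : (1 - G.sectionMatrix t).det ≠ 0) (w : G.Coord t → ℝ) :
    G.flowExtend x₀ t w ∈ G.hat.flowSpace (false, x₀) := by
  rw [mem_hat_flowSpace_iff]
  have h1 : ∀ x, ∑ e with G.tail e = x, G.flowExtend x₀ t w (Sum.inl e)
      = G.flowMass x₀ t w x := by
    intro x
    rw [G.sum_tail_eq ht (fun e => G.flowExtend x₀ t w (Sum.inl e)), G.flowExtend_section x₀ ht]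
    simp only [flowExtend_coord]
    ring
  refine ⟨h1, fun x => ?_⟩
  rw [G.sum_head_eq_vecMul_section ht (fun e => G.flowExtend x₀ t w (Sum.inl e))]
  simp only [h1, flowExtend_coord]
  have h2 : Matrix.vecMul (G.flowMass x₀ t w) (1 - G.sectionMatrix t)
      = Pi.single x₀ 1 + Matrix.vecMul w (G.coordIncidence t) := by
    rw [flowMass, Matrix.vecMul_vecMul, Matrix.nonsing_inv_mul _ (Ne.isUnit hdet),
      Matrix.vecMul_one]
  have h3 := congrFun h2 x
  rw [Matrix.vecMul_sub, Matrix.vecMul_one, Pi.sub_apply, Pi.add_apply] at h3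
  change G.flowMass x₀ t w x - _ = _
  linarith

/-- Since I - S is invertible, conservation determines the flow from its values off t; these are
global affine coordinates. -/
theorem flowExtend_restrict {x₀ : U} {t : U → E} (ht : ∀ x, G.tail (t x) = x)
    (hdet : (1 - G.sectionMatrix t).det ≠ 0) {z : E ⊕ U → ℝ}
    (hz : z ∈ G.hat.flowSpace (false, x₀)) :
    G.flowExtend x₀ t (fun e => z (Sum.inl e)) = z := by
  obtain ⟨hout, hin⟩ := (G.mem_hat_flowSpace_iff x₀ z).mp hz
  have hmass : G.flowMass x₀ t (fun e => z (Sum.inl e)) = fun x => z (Sum.inr x) := by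
    have h1 : Pi.single x₀ 1
        + Matrix.vecMul (fun e : G.Coord t => z (Sum.inl e)) (G.coordIncidence t)
        = Matrix.vecMul (fun x => z (Sum.inr x)) (1 - G.sectionMatrix t) := by
      ext y
      rw [Matrix.vecMul_sub, Matrix.vecMul_one, Pi.sub_apply, Pi.add_apply, ← hin y,
        G.sum_head_eq_vecMul_section ht (fun e => z (Sum.inl e))]
      simp only [hout]
      ring
    rw [flowMass, h1, Matrix.vecMul_vecMul, Matrix.mul_nonsing_inv _ (Ne.isUnit hdet),
      Matrix.vecMul_one]
  ext f
  rcases f with e | x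
  · by_cases he : e = t (G.tail e)
    · conv_lhs => rw [he]
      rw [G.flowExtend_section x₀ ht, hmass]
      beta_reduce
      rw [← hout, G.sum_tail_eq ht (fun e => z (Sum.inl e)), ← he]
      ring
    · exact dif_pos he
  · exact congrFun hmass x

/-! ### The change of variables from flows to environments -/

/-- The coordinates of the positive flows. -/
def flowCone (x₀ : U) (t : U → E) : Set (G.Coord t → ℝ) :=
  {w | ∀ f, 0 < G.flowExtend x₀ t w f}

/-- The environment of a flow, in coordinates off the section `t`. -/
def flowChart (x₀ : U) (t : U → E) (w : G.Coord t → ℝ) (e : G.Coord t) : ℝ :=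
  w e / G.flowMass x₀ t w (G.tail e)

/-- The linear part of `flowMass`. -/
def flowMassLinear (t : U → E) (x : U) : (G.Coord t → ℝ) →L[ℝ] ℝ :=
  ∑ f, (G.coordIncidence t * (1 - G.sectionMatrix t)⁻¹) f x • ContinuousLinearMap.proj f

theorem flowMassLinear_apply (t : U → E) (x : U) (v : G.Coord t → ℝ) :
    G.flowMassLinear t x v
      = ∑ f, (G.coordIncidence t * (1 - G.sectionMatrix t)⁻¹) f x * v f := by
  simp [flowMassLinear]

theorem flowMass_eq (x₀ : U) (t : U → E) (w : G.Coord t → ℝ) (x : U) :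
    G.flowMass x₀ t w x
      = Matrix.vecMul (Pi.single x₀ 1) (1 - G.sectionMatrix t)⁻¹ x + G.flowMassLinear t x w := by
  rw [flowMass, Matrix.add_vecMul, Matrix.vecMul_vecMul, Pi.add_apply, flowMassLinear_apply]
  congr 1
  simp only [Matrix.vecMul, dotProduct]
  exact Finset.sum_congr rfl fun f _ => mul_comm _ _

theorem hasFDerivAt_flowMass (x₀ : U) (t : U → E) (w : G.Coord t → ℝ) (x : U) :
    HasFDerivAt (fun w => G.flowMass x₀ t w x) (G.flowMassLinear t x) w := by
  simp only [flowMass_eq]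
  exact (G.flowMassLinear t x).hasFDerivAt.const_add _

theorem isOpen_flowCone (x₀ : U) (t : U → E) : IsOpen (G.flowCone x₀ t) := by
  have hm : ∀ x, Continuous fun w => G.flowMass x₀ t w x := fun x =>
    continuous_iff_continuousAt.mpr fun w => (G.hasFDerivAt_flowMass x₀ t w x).continuousAt
  simp only [flowCone, Set.ofPred_forall]
  refine isOpen_iInter_of_finite fun f => isOpen_lt continuous_const ?_
  rcases f with e | x
  · by_cases h : e ≠ t (G.tail e)
    · simp only [flowExtend, Sum.elim_inl, dif_pos h]
      fun_prop
    · simp only [flowExtend, Sum.elim_inl, dif_neg h, coordSum]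
      refine (hm _).sub (continuous_finsetSum _ fun f _ => ?_)
      split_ifs <;> fun_prop
  · exact hm x

/-- The Jacobian matrix of `flowChart`. -/
def flowJacobian (x₀ : U) (t : U → E) (w : G.Coord t → ℝ) : Matrix (G.Coord t) (G.Coord t) ℝ :=
  Matrix.of fun e f => (G.flowMass x₀ t w (G.tail e))⁻¹ * ((1 : Matrix _ _ ℝ) e f -
    (G.coordIncidence t * (1 - G.sectionMatrix t)⁻¹) f (G.tail e) * G.flowChart x₀ t w e)

theorem hasFDerivAt_flowChart {x₀ : U} {t : U → E} {w : G.Coord t → ℝ}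
    (hw : w ∈ G.flowCone x₀ t) :
    HasFDerivAt (G.flowChart x₀ t)
      (Matrix.toLin' (G.flowJacobian x₀ t w)).toContinuousLinearMap w := by
  have hpi : (Matrix.toLin' (G.flowJacobian x₀ t w)).toContinuousLinearMap =
      ContinuousLinearMap.pi fun e => (ContinuousLinearMap.proj e).comp
        (Matrix.toLin' (G.flowJacobian x₀ t w)).toContinuousLinearMap := by
    ext; rfl
  rw [hpi]
  refine hasFDerivAt_pi.mpr fun e => ?_
  have hg : G.flowMass x₀ t w (G.tail e) ≠ 0 := (hw (Sum.inr (G.tail e))).ne'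
  have h1 : HasFDerivAt (fun w : G.Coord t → ℝ => w e)
      (ContinuousLinearMap.proj (R := ℝ) (φ := fun _ : G.Coord t => ℝ) e) w :=
    (ContinuousLinearMap.proj (R := ℝ) (φ := fun _ : G.Coord t => ℝ) e).hasFDerivAt
  have h2 := (hasDerivAt_inv hg).comp_hasFDerivAt w (G.hasFDerivAt_flowMass x₀ t w (G.tail e))
  have h3 := h1.mul h2
  refine h3.congr_fderiv ?_
  ext1 v
  have h4 : ((ContinuousLinearMap.proj e).comp
      (Matrix.toLin' (G.flowJacobian x₀ t w)).toContinuousLinearMap) v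
      = (G.flowMass x₀ t w (G.tail e))⁻¹ *
        (v e - G.flowMassLinear t (G.tail e) v * G.flowChart x₀ t w e) := by
    change Matrix.mulVec (G.flowJacobian x₀ t w) v e = _
    rw [flowMassLinear_apply, Finset.sum_mul]
    simp only [Matrix.mulVec, dotProduct, flowJacobian, Matrix.of_apply, mul_assoc]
    rw [← Finset.mul_sum]
    congr 1
    simp only [sub_mul, Finset.sum_sub_distrib]
    congr 1
    · simp [Matrix.one_apply]
    · exact Finset.sum_congr rfl fun f _ => by ring
  refine Eq.trans ?_ h4.symm
  simp only [add_apply, FunLike.coe_smul, Pi.smul_apply, smul_eq_mul, ContinuousLinearMap.proj_apply,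
    Function.comp_apply, flowChart]
  field_simp
  ring

/-- By det(1 - AB) = det(1 - BA) the determinant moves from the edges off t to U, where BA = (P -
S)(I - S)⁻¹. Then 1 - BA = (I - P)(I - S)⁻¹, and det(I - S) = 1. -/
theorem det_one_sub_incidence_mul {t : U → E} (ht : ∀ x, G.tail (t x) = x)
    (hdet : (1 - G.sectionMatrix t).det = 1) {p : E → ℝ} (hp : p ∈ G.environments) :
    (1 - G.coordIncidence t * (1 - G.sectionMatrix t)⁻¹ *
      Matrix.of fun (y : U) (e : G.Coord t) => if G.tail e = y then p e else 0).det
      = (1 - G.transitionMatrix p).det := by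
  have hunit : IsUnit (1 - G.sectionMatrix t).det := by rw [hdet]; exact isUnit_one
  have hBA : (Matrix.of fun (y : U) (e : G.Coord t) => if G.tail e = y then p e else 0)
      * G.coordIncidence t = G.transitionMatrix p - G.sectionMatrix t := by
    ext x y
    have h1 := G.sum_tail_eq ht
      (fun e => p e * ((if G.head e = some y then 1 else 0) - G.sectionMatrix t (G.tail e) y)) x
    have h2 : ∑ e with G.tail e = x,
        p e * ((if G.head e = some y then 1 else 0) - G.sectionMatrix t (G.tail e) y)
        = G.transitionMatrix p x y - G.sectionMatrix t x y := by
      have h3 : ∑ e with G.tail e = x,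
          p e * ((if G.head e = some y then 1 else 0) - G.sectionMatrix t (G.tail e) y)
          = ∑ e with G.tail e = x,
            ((if G.head e = some y then p e else 0) - p e * G.sectionMatrix t x y) := by
        refine Finset.sum_congr rfl fun e he => ?_
        rw [(Finset.mem_filter.mp he).2]
        simp [mul_sub]
      rw [h3, Finset.sum_sub_distrib, ← Finset.sum_mul, hp.2, one_mul, transitionMatrix_apply,
        ← Finset.filter_filter, ← Finset.sum_filter]
    -- The section edge contributes zero, so the sum over edges off t may be taken over all edges
    -- with origin x, whose weights add up to 1.
    have h4 : (if G.head (t x) = some y then (1 : ℝ) else 0) - G.sectionMatrix t (G.tail (t x)) y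
        = 0 := by
      simp [sectionMatrix, ht]
    rw [h2, h4, mul_zero, zero_add] at h1
    rw [Matrix.sub_apply, h1, Matrix.mul_apply, coordSum]
    refine Finset.sum_congr rfl fun e _ => ?_
    simp [coordIncidence]
  rw [Matrix.det_one_sub_mul_comm, ← Matrix.mul_assoc, hBA]
  have h5 : 1 - (G.transitionMatrix p - G.sectionMatrix t) * (1 - G.sectionMatrix t)⁻¹
      = (1 - G.transitionMatrix p) * (1 - G.sectionMatrix t)⁻¹ := by
    have h6 := Matrix.mul_nonsing_inv _ hunit
    calc _ = (1 - G.sectionMatrix t) * (1 - G.sectionMatrix t)⁻¹ -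
          (G.transitionMatrix p - G.sectionMatrix t) * (1 - G.sectionMatrix t)⁻¹ := by rw [h6]
      _ = _ := by rw [← Matrix.sub_mul, sub_sub_sub_cancel_right]
  rw [h5, Matrix.det_mul, Matrix.det_nonsing_inv, hdet]
  simp

theorem flowEnv_flowExtend_coord (x₀ : U) (t : U → E) (w : G.Coord t → ℝ) (e : G.Coord t) :
    G.flowEnv (G.flowExtend x₀ t w) e = G.flowChart x₀ t w e := by
  rw [flowEnv, flowExtend_coord]
  rfl

/-- Taking 1/g out of each row leaves the transpose of the matrix of `det_one_sub_incidence_mul` for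
the environment of the flow. -/
theorem det_flowJacobian {x₀ : U} {t : U → E} (ht : ∀ x, G.tail (t x) = x)
    (hdet : (1 - G.sectionMatrix t).det = 1) {w : G.Coord t → ℝ} (hw : w ∈ G.flowCone x₀ t) :
    (G.flowJacobian x₀ t w).det = (∏ e : G.Coord t, (G.flowMass x₀ t w (G.tail e))⁻¹) *
      (1 - G.transitionMatrix (G.flowEnv (G.flowExtend x₀ t w))).det := by
  have hmem := G.flowEnv_mem (G.flowExtend_mem x₀ ht (hdet ▸ one_ne_zero) w) hw
  have hJ : G.flowJacobian x₀ t w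
      = Matrix.diagonal (fun e : G.Coord t => (G.flowMass x₀ t w (G.tail e))⁻¹) *
        (1 - G.coordIncidence t * (1 - G.sectionMatrix t)⁻¹ * Matrix.of fun (y : U)
          (e : G.Coord t) => if G.tail e = y then G.flowEnv (G.flowExtend x₀ t w) e else 0).transpose := by
    ext e f
    rw [Matrix.diagonal_mul, Matrix.transpose_apply, Matrix.sub_apply, Matrix.mul_apply]
    simp only [flowJacobian, Matrix.of_apply, flowEnv_flowExtend_coord]
    congr 2
    · simp [Matrix.one_apply, eq_comm]
    · simp
  rw [hJ, Matrix.det_mul, Matrix.det_diagonal, Matrix.det_transpose,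
    G.det_one_sub_incidence_mul ht hdet hmem]

theorem envExtend_flowChart {x₀ : U} {t : U → E} (ht : ∀ x, G.tail (t x) = x)
    (hdet : (1 - G.sectionMatrix t).det ≠ 0) {w : G.Coord t → ℝ} (hw : w ∈ G.flowCone x₀ t) :
    G.envExtend t (G.flowChart x₀ t w) = G.flowEnv (G.flowExtend x₀ t w) := by
  have hmem := G.flowEnv_mem (G.flowExtend_mem x₀ ht hdet w) hw
  refine Eq.trans (congrArg _ ?_) (G.envExtend_envCoord ht ⟨_, hmem⟩)
  ext e
  exact (G.flowEnv_flowExtend_coord x₀ t w e).symm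

/-- The flow is recovered from its environment as the occupation field. -/
theorem injOn_flowChart {x₀ : U} {t : U → E} (ht : ∀ x, G.tail (t x) = x)
    (hcyc : ¬ G.ContainsCycle (Set.range t)) :
    Set.InjOn (G.flowChart x₀ t) (G.flowCone x₀ t) := by
  have hdet : (1 - G.sectionMatrix t).det ≠ 0 := by
    rw [G.det_one_sub_sectionMatrix ht hcyc]; exact one_ne_zero
  have key : ∀ w ∈ G.flowCone x₀ t, w = fun e : G.Coord t =>
      G.occupation x₀ (G.envExtend t (G.flowChart x₀ t w)) e := by
    intro w hw
    ext e
    have hz := G.flowExtend_mem x₀ ht hdet w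
    rw [G.envExtend_flowChart ht hdet hw, ← G.flow_eq_occupation hz hw
      (G.det_pos (G.flowEnv_mem hz hw) ht hcyc).ne', flowExtend_coord]
  intro w hw w' hw' h
  rw [key w hw, key w' hw', h]

/-- The preimage of an environment is its occupation field. Admissibility enters here: it makes the
Green function, hence the flow, strictly positive. -/
theorem image_flowChart {x₀ : U} (hG : G.IsAdmissible x₀) {t : U → E}
    (ht : ∀ x, G.tail (t x) = x) (hcyc : ¬ G.ContainsCycle (Set.range t)) :
    G.flowChart x₀ t '' G.flowCone x₀ t = Set.range (G.envCoord t) := by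
  have hdet : (1 - G.sectionMatrix t).det ≠ 0 := by
    rw [G.det_one_sub_sectionMatrix ht hcyc]; exact one_ne_zero
  ext q
  constructor
  · rintro ⟨w, hw, rfl⟩
    refine ⟨⟨_, G.flowEnv_mem (G.flowExtend_mem x₀ ht hdet w) hw⟩, ?_⟩
    ext e
    exact G.flowEnv_flowExtend_coord x₀ t w e
  · rintro ⟨⟨p, hp⟩, rfl⟩
    have hd := (G.det_pos hp ht hcyc).ne'
    set z : E ⊕ U → ℝ := Sum.elim (G.occupation x₀ p) (G.green p x₀) with hz
    have hflow := G.flowExtend_restrict ht hdet (G.occupation_mem_flowSpace hp x₀ hd)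
    have hpos : ∀ f, 0 < z f := by
      rintro (e | x)
      · exact G.occupation_pos hp hd hG e
      · exact G.green_pos hp hd hG x
    refine ⟨fun e => z (Sum.inl e), ?_, ?_⟩
    · intro f
      rw [hflow]
      exact hpos f
    · ext e
      rw [← flowEnv_flowExtend_coord, hflow]
      exact mul_div_cancel_left₀ _ (hpos (Sum.inr (G.tail e))).ne'

/-! ### The volume on the space of flows -/

theorem inl_mem_hatTree {T : Finset E} (e : E) :
    (Sum.inl e : E ⊕ U) ∈ hatTree (U := U) T ↔ e ∈ T := by
  simp [hatTree]

theorem inr_mem_hatTree {T : Finset E} (x : U) :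
    (Sum.inr x : E ⊕ U) ∈ hatTree (U := U) T := by
  simp [hatTree]

/-- The edges off the tree of the bipartite graph are the edges off the section `t`. -/
def hatCoordEquiv {t : U → E} {T : Finset E} (hT : ∀ e, e ∈ T ↔ e = t (G.tail e)) :
    G.Coord t ≃ {f : E ⊕ U // f ∉ hatTree (U := U) T} :=
  Equiv.ofBijective (fun e => ⟨Sum.inl e, by rw [inl_mem_hatTree, hT]; exact e.2⟩) (by
    constructor
    · intro e e' h
      exact Subtype.ext (Sum.inl_injective (congrArg Subtype.val h))
    · rintro ⟨e | x, h⟩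
      · exact ⟨⟨e, by rwa [inl_mem_hatTree, hT] at h⟩, rfl⟩
      · exact absurd (inr_mem_hatTree x) h)

/-- The coordinates off the section `t` of a flow on the bipartite graph. -/
def flowCoord (x₀ : U) (t : U → E) (z : G.hat.flowSpace (false, x₀)) (e : G.Coord t) : ℝ :=
  (z : E ⊕ U → ℝ) (Sum.inl e)

theorem flowExtend_flowCoord {x₀ : U} {t : U → E} (ht : ∀ x, G.tail (t x) = x)
    (hdet : (1 - G.sectionMatrix t).det ≠ 0) (z : G.hat.flowSpace (false, x₀)) :
    G.flowExtend x₀ t (G.flowCoord x₀ t z) = z :=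
  G.flowExtend_restrict ht hdet z.2

theorem measurableEmbedding_flowCoord {x₀ : U} {t : U → E} (ht : ∀ x, G.tail (t x) = x)
    (hdet : (1 - G.sectionMatrix t).det ≠ 0) : MeasurableEmbedding (G.flowCoord x₀ t) := by
  have hclosed : IsClosed (G.hat.flowSpace (false, x₀)) := by
    refine isClosed_eq (continuous_pi fun v => ?_) continuous_const
    simp only [divergence]
    fun_prop
  have := hclosed.measurableSet.standardBorel
  refine Measurable.measurableEmbedding ?_ ?_
  · refine measurable_pi_lambda _ fun e => ?_
    exact (measurable_pi_apply (Sum.inl (e : E) : E ⊕ U)).comp measurable_subtype_coe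
  · intro z z' h
    apply Subtype.ext
    rw [← G.flowExtend_flowCoord ht hdet z, ← G.flowExtend_flowCoord ht hdet z', h]

theorem range_flowCoord {x₀ : U} {t : U → E} (ht : ∀ x, G.tail (t x) = x)
    (hdet : (1 - G.sectionMatrix t).det ≠ 0) : Set.range (G.flowCoord x₀ t) = Set.univ := by
  refine Set.eq_univ_of_forall fun w => ⟨⟨_, G.flowExtend_mem x₀ ht hdet w⟩, ?_⟩
  ext e
  exact G.flowExtend_coord x₀ t w e

/-- All edges ê_x belong to `hatTree`, so its complement is a copy of the edges off t. The reference
measure is then Lebesgue measure up to relabelling, on the whole coordinate space. -/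
theorem map_flowCoord_coordVolume {x₀ : U} {t : U → E} (ht : ∀ x, G.tail (t x) = x)
    (hdet : (1 - G.sectionMatrix t).det ≠ 0) {T : Finset E}
    (hT : ∀ e, e ∈ T ↔ e = t (G.tail e)) :
    (G.hat.coordVolume (false, x₀) (hatTree T)).map (G.flowCoord x₀ t) = volume := by
  have hemb := G.measurableEmbedding_flowCoord (x₀ := x₀) ht hdet
  set σ := MeasurableEquiv.arrowCongr' (G.hatCoordEquiv hT) (MeasurableEquiv.refl ℝ) with hσ
  have hpres : MeasurePreserving σ :=
    volume_preserving_arrowCongr' _ _ (MeasurePreserving.id volume)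
  have hcomp : (fun (z : G.hat.flowSpace (false, x₀))
      (f : {f : E ⊕ U // f ∉ hatTree (U := U) T}) => (z : E ⊕ U → ℝ) f)
      = σ ∘ G.flowCoord x₀ t := by
    ext z f
    obtain ⟨e, rfl⟩ := (G.hatCoordEquiv hT).surjective f
    change _ = G.flowCoord x₀ t z ((G.hatCoordEquiv hT).symm (G.hatCoordEquiv hT e))
    rw [Equiv.symm_apply_apply]
    rfl
  have hvol : G.hat.coordVolume (false, x₀) (hatTree T) = volume.comap (G.flowCoord x₀ t) := by
    rw [coordVolume, hcomp, ← Measure.comap_comap (fun s hs => hemb.measurableSet_image.mpr hs)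
      σ.injective (fun s hs => σ.measurableEmbedding.measurableSet_image.mpr hs)]
    congr 1
    have := σ.symm.comap_symm (μ := volume)
    rw [σ.symm_symm] at this
    rw [this, hpres.symm.map_eq]
  rw [hvol, hemb.map_comap, G.range_flowCoord ht hdet, Measure.restrict_univ]

theorem preimage_flowCone {x₀ : U} {t : U → E} (ht : ∀ x, G.tail (t x) = x)
    (hdet : (1 - G.sectionMatrix t).det ≠ 0) :
    G.flowCoord x₀ t ⁻¹' G.flowCone x₀ t = G.hat.domain (false, x₀) := by
  ext z
  change (∀ f, 0 < G.flowExtend x₀ t (G.flowCoord x₀ t z) f) ↔ ∀ f, 0 < (z : E ⊕ U → ℝ) f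
  rw [G.flowExtend_flowCoord ht hdet]

theorem hyperIntegrable_iff {x₀ : U} {t : U → E} (ht : ∀ x, G.tail (t x) = x)
    (hdet : (1 - G.sectionMatrix t).det ≠ 0) {T : Finset E}
    (hT : ∀ e, e ∈ T ↔ e = t (G.tail e)) (a : E ⊕ U → ℝ) (l : E ⊕ U → ℂ) :
    G.hat.HyperIntegrable (false, x₀) (hatTree T) a l ↔
      IntegrableOn (fun w => hyperIntegrand (hatTree T) a l (G.flowExtend x₀ t w))
        (G.flowCone x₀ t) := by
  rw [← G.map_flowCoord_coordVolume (x₀ := x₀) ht hdet hT,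
    (G.measurableEmbedding_flowCoord ht hdet).integrableOn_map_iff, G.preimage_flowCone ht hdet]
  simp only [Function.comp_def, G.flowExtend_flowCoord ht hdet]
  rfl

theorem hyperIntegral_eq {x₀ : U} {t : U → E} (ht : ∀ x, G.tail (t x) = x)
    (hdet : (1 - G.sectionMatrix t).det ≠ 0) {T : Finset E}
    (hT : ∀ e, e ∈ T ↔ e = t (G.tail e)) (a : E ⊕ U → ℝ) (l : E ⊕ U → ℂ) :
    G.hat.hyperIntegral (false, x₀) (hatTree T) a l =
      ∫ w in G.flowCone x₀ t, hyperIntegrand (hatTree T) a l (G.flowExtend x₀ t w) := by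
  rw [← G.map_flowCoord_coordVolume (x₀ := x₀) ht hdet hT,
    (G.measurableEmbedding_flowCoord ht hdet).setIntegral_map, G.preimage_flowCone ht hdet]
  simp only [G.flowExtend_flowCoord ht hdet]
  rfl

/-! ### The Dirichlet law in coordinates -/

/-- The density of the Dirichlet law. -/
def dirichletDensity (α : E → ℝ) (p : E → ℝ) : ℝ := G.normConst α * ∏ e, p e ^ (α e - 1)

theorem dirichletDensity_nonneg {r : U → E} (hr : ∀ x, G.tail (r x) = x)
    {α : E → ℝ} (hα : ∀ e, 0 < α e) {p : E → ℝ} (hp : p ∈ G.environments) :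
    0 ≤ G.dirichletDensity α p :=
  mul_nonneg (G.normConst_pos hr hα).le
    (Finset.prod_nonneg fun e _ => Real.rpow_nonneg (hp.1 e).1.le _)

theorem measurable_dirichletDensity (α : E → ℝ) :
    Measurable fun p : G.environments => ENNReal.ofReal (G.dirichletDensity α p) :=
  (measurable_const.mul (Finset.measurable_prod _ fun e _ =>
    (G.measurable_env_apply e).pow_const _)).ennreal_ofReal

/-- The law is defined with an arbitrary section r, while the change of variables uses the section t
of the tree; `environmentVolume_congr` passes from one to the other. -/
theorem integrable_dirichletLaw_iff {r t : U → E} (hr : ∀ x, G.tail (r x) = x)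
    (ht : ∀ x, G.tail (t x) = x) {α : E → ℝ} (hα : ∀ e, 0 < α e) (F : (E → ℝ) → ℂ) :
    Integrable (fun p : G.environments => F p) (G.dirichletLaw r α) ↔
      IntegrableOn (fun q => G.dirichletDensity α (G.envExtend t q) • F (G.envExtend t q))
        (Set.range (G.envCoord t)) := by
  have hemb := G.measurableEmbedding_envCoord ht
  rw [dirichletLaw, G.environmentVolume_congr hr ht]
  refine (integrable_withDensity_iff_integrable_smul' (G.measurable_dirichletDensity α)
    (Filter.Eventually.of_forall fun _ => ENNReal.ofReal_lt_top)).trans ?_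
  rw [IntegrableOn, ← hemb.map_comap, hemb.integrable_map_iff]
  simp only [Function.comp_def, G.envExtend_envCoord ht,
    ENNReal.toReal_ofReal (G.dirichletDensity_nonneg hr hα (Subtype.property _))]
  rfl

theorem integral_dirichletLaw_eq {r t : U → E} (hr : ∀ x, G.tail (r x) = x)
    (ht : ∀ x, G.tail (t x) = x) {α : E → ℝ} (hα : ∀ e, 0 < α e) (F : (E → ℝ) → ℂ) :
    ∫ p : G.environments, F p ∂(G.dirichletLaw r α) =
      ∫ q in Set.range (G.envCoord t),
        G.dirichletDensity α (G.envExtend t q) • F (G.envExtend t q) := by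
  have hemb := G.measurableEmbedding_envCoord ht
  rw [dirichletLaw, G.environmentVolume_congr hr ht]
  refine (integral_withDensity_eq_integral_toReal_smul (G.measurable_dirichletDensity α)
    (Filter.Eventually.of_forall fun _ => ENNReal.ofReal_lt_top) _).trans ?_
  rw [← hemb.map_comap, hemb.integral_map]
  simp only [G.envExtend_envCoord ht,
    ENNReal.toReal_ofReal (G.dirichletDensity_nonneg hr hα (Subtype.property _))]
  rfl

/-! ### Comparison of the integrands -/

/-- Grouping edges by origin turns the exponents α_e into β_x, which the weights -β_x on the edges
ê_x cancel. -/
theorem prod_rpow_tail {g : U → ℝ} (hg : ∀ x, 0 < g x) (α : E → ℝ) :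
    ∏ e, g (G.tail e) ^ α e = ∏ x, g x ^ G.outWeight α x := by
  rw [← Finset.prod_fiberwise Finset.univ G.tail]
  refine Finset.prod_congr rfl fun x _ => ?_
  rw [outWeight, Real.rpow_sum_of_pos (hg x)]
  exact Finset.prod_congr rfl fun e he => by rw [(Finset.mem_filter.mp he).2]

/-- With z = g p, the powers of g cancel by the choice of -β_x, and the inverses of g off t are
those of the Jacobian. The inverses of p off t equal the inverses of all p_e times the product of p
over the section. The factor `d` of the Jacobian cancels the denominator. -/
theorem density_identity {t : U → E} (ht : ∀ x, G.tail (t x) = x) {g : U → ℝ} (hg : ∀ x, 0 < g x)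
    {p : E → ℝ} (hp : ∀ e, 0 < p e) (α : E → ℝ) {d : ℝ} (hd : d ≠ 0) :
    (∏ e : G.Coord t, (g (G.tail e))⁻¹) * d * ((∏ e, p e ^ (α e - 1)) * ((∏ x, p (t x)) / d)) =
      (∏ e, (g (G.tail e) * p e) ^ α e) * (∏ x, g x ^ (-G.outWeight α x)) *
        ∏ e : G.Coord t, (g (G.tail e) * p e)⁻¹ := by
  have h1 : ∏ e, p e ^ (α e - 1) = (∏ e, p e ^ α e) * (∏ e, p e)⁻¹ := by
    rw [← Finset.prod_inv_distrib, ← Finset.prod_mul_distrib]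
    exact Finset.prod_congr rfl fun e _ => by rw [Real.rpow_sub_one (hp e).ne']; rfl
  have h2 : ∏ e, (g (G.tail e) * p e) ^ α e
      = (∏ x, g x ^ G.outWeight α x) * ∏ e, p e ^ α e := by
    rw [← G.prod_rpow_tail hg, ← Finset.prod_mul_distrib]
    exact Finset.prod_congr rfl fun e _ => Real.mul_rpow (hg _).le (hp e).le
  have h3 : ∏ x, g x ^ (-G.outWeight α x) = (∏ x, g x ^ G.outWeight α x)⁻¹ := by
    rw [← Finset.prod_inv_distrib]
    exact Finset.prod_congr rfl fun x _ => Real.rpow_neg (hg x).le _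
  have h4 : ∏ e : G.Coord t, (g (G.tail e) * p e)⁻¹
      = (∏ e : G.Coord t, (g (G.tail e))⁻¹) * (∏ e : G.Coord t, p e)⁻¹ := by
    rw [← Finset.prod_inv_distrib, ← Finset.prod_mul_distrib]
    exact Finset.prod_congr rfl fun e _ => mul_inv _ _
  have h5 := G.prod_eq_prod_section_mul ht p
  have h6 : ∏ x, g x ^ G.outWeight α x ≠ 0 :=
    (Finset.prod_pos fun x _ => Real.rpow_pos_of_pos (hg x) _).ne'
  have h7 : ∏ x, p (t x) ≠ 0 := (Finset.prod_pos fun x _ => hp _).ne'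
  have h8 : ∏ e : G.Coord t, p e ≠ 0 := (Finset.prod_pos fun e _ => hp _).ne'
  rw [h1, h2, h3, h4, h5]
  field_simp

theorem prod_compl_hatTree {t : U → E} {T : Finset E} (hT : ∀ e, e ∈ T ↔ e = t (G.tail e))
    (f : E ⊕ U → ℝ) : ∏ i ∈ (hatTree (U := U) T)ᶜ, f i = ∏ e : G.Coord t, f (Sum.inl e) := by
  rw [Finset.prod_subtype (p := fun i => i ∉ hatTree (U := U) T) _ (by simp)]
  exact ((G.hatCoordEquiv hT).prod_comp fun i => f i).symm

theorem jacobian_smul_eq {x₀ : U} {t : U → E} (ht : ∀ x, G.tail (t x) = x)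
    (hcyc : ¬ G.ContainsCycle (Set.range t)) {T : Finset E}
    (hT : ∀ e, e ∈ T ↔ e = t (G.tail e)) (α : E → ℝ) (l : E → ℂ)
    {w : G.Coord t → ℝ} (hw : w ∈ G.flowCone x₀ t) :
    |(Matrix.toLin' (G.flowJacobian x₀ t w)).toContinuousLinearMap.det| •
      (G.dirichletDensity α (G.envExtend t (G.flowChart x₀ t w)) •
        G.laplaceFunctional x₀ T l (G.envExtend t (G.flowChart x₀ t w))) =
      (G.normConst α : ℂ) * hyperIntegrand (hatTree T) (G.hatWeight α) (hatParam l)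
        (G.flowExtend x₀ t w) := by
  have hdet1 := G.det_one_sub_sectionMatrix ht hcyc
  have hdet : (1 - G.sectionMatrix t).det ≠ 0 := by rw [hdet1]; exact one_ne_zero
  have hz := G.flowExtend_mem x₀ ht hdet w
  have hp := G.flowEnv_mem hz hw
  have hd := G.det_pos hp ht hcyc
  have hocc := G.flow_eq_occupation hz hw hd.ne'
  have hg : ∀ x, 0 < G.flowMass x₀ t w x := fun x => hw (Sum.inr x)
  have hJ : (Matrix.toLin' (G.flowJacobian x₀ t w)).toContinuousLinearMap.det
      = (G.flowJacobian x₀ t w).det := LinearMap.det_toLin' _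
  rw [G.envExtend_flowChart ht hdet hw, hJ, G.det_flowJacobian ht hdet1 hw]
  set z := G.flowExtend x₀ t w with hzdef
  set p := G.flowEnv z with hpdef
  set d := (1 - G.transitionMatrix p).det with hddef
  have hzp : ∀ e, z (Sum.inl e) = G.flowMass x₀ t w (G.tail e) * p e := fun e =>
    (mul_div_cancel₀ _ (hg (G.tail e)).ne').symm
  have hTprod : ∏ e ∈ T, p e = ∏ x, p (t x) := by
    rw [← G.prod_section ht]
    exact Finset.prod_congr (by ext; simp [hT]) fun _ _ => rfl
  have hid := G.density_identity ht hg (fun e => (hp.1 e).1) α hd.ne'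
  have hexp : ∑ f, hatParam (U := U) l f * (z f : ℂ) = ∑ e, l e * (G.occupation x₀ p e : ℂ) := by
    simp [Fintype.sum_sum_type, hatParam, hocc]
  have hprod : ∏ f, z f ^ G.hatWeight α f =
      (∏ e, (G.flowMass x₀ t w (G.tail e) * p e) ^ α e) *
        ∏ x, G.flowMass x₀ t w x ^ (-G.outWeight α x) := by
    simp only [Fintype.prod_sum_type, hatWeight, Sum.elim_inl, Sum.elim_inr, hzp]
    rfl
  have hcompl : ∏ f ∈ (hatTree (U := U) T)ᶜ, (z f)⁻¹
      = ∏ e : G.Coord t, (G.flowMass x₀ t w (G.tail e) * p e)⁻¹ := by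
    rw [G.prod_compl_hatTree hT fun f => (z f)⁻¹]
    simp only [hzp]
  rw [abs_of_pos (mul_pos (Finset.prod_pos fun e _ => inv_pos.mpr (hg _)) hd),
    hyperIntegrand, hexp, hprod, hcompl, laplaceFunctional, hTprod, dirichletDensity,
    Complex.real_smul, Complex.real_smul]
  rw [mul_assoc (Complex.exp _), ← Complex.ofReal_mul, ← hid]
  push_cast
  ring

end KilledGraph

/-! ### The main theorem -/

theorem theorem2p1 {U E : Type*} [Fintype U] [DecidableEq U] [Fintype E] [DecidableEq E]
    (G : KilledGraph U E) (x₀ : U) (hG : G.IsAdmissible x₀)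
    (α : E → ℝ) (hα : ∀ e, 0 < α e)
    (r : U → E) (hr : ∀ x, G.tail (r x) = x)
    (T : Finset E) (hT : G.IsDirectedSpanningTree T)
    (l : E → ℂ) (hl : ∀ e, 0 < (l e).re) :
    G.hat.HyperIntegrable (false, x₀) (KilledGraph.hatTree T) (G.hatWeight α)
        (KilledGraph.hatParam l) ∧
      (∀ p ∈ G.environments, (1 - G.transitionMatrix p).det ≠ 0) ∧
      Integrable (fun p : G.environments =>
        Complex.exp (-∑ e, l e * (G.occupation x₀ p e : ℂ)) *
          (((∏ e ∈ T, (p : E → ℝ) e) / (1 - G.transitionMatrix p).det : ℝ) : ℂ))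
        (G.dirichletLaw r α) ∧
      (G.normConst α : ℂ) *
          G.hat.hyperIntegral (false, x₀) (KilledGraph.hatTree T) (G.hatWeight α)
            (KilledGraph.hatParam l) =
        ∫ p : G.environments,
          Complex.exp (-∑ e, l e * (G.occupation x₀ p e : ℂ)) *
            (((∏ e ∈ T, (p : E → ℝ) e) / (1 - G.transitionMatrix p).det : ℝ) : ℂ)
          ∂(G.dirichletLaw r α) ∧
      ∀ p ∈ G.environments, ∀ {Ω : Type*} [MeasurableSpace Ω] (ℙ : Measure Ω)
        (X : ℕ → Ω → Option U), G.IsMarkovChain x₀ p ℙ X →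
          ∀ e, G.expectedCrossings ℙ X e = ENNReal.ofReal (G.occupation x₀ p e) := by
  obtain ⟨t, ht, hTt⟩ := hT.exists_section
  have hcyc : ¬ G.ContainsCycle (Set.range t) := by
    have hrange : Set.range t = (T : Set E) := by
      ext e
      rw [Finset.mem_coe, hTt]
      exact ⟨by rintro ⟨x, rfl⟩; rw [ht], fun h => ⟨_, h.symm⟩⟩
    rw [hrange]
    exact hT.1.1
  have hsec : (1 - G.sectionMatrix t).det ≠ 0 := by
    rw [G.det_one_sub_sectionMatrix ht hcyc]; exact one_ne_zero
  have hdet : ∀ p ∈ G.environments, (1 - G.transitionMatrix p).det ≠ 0 := fun p hp =>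
    (G.det_pos hp ht hcyc).ne'
  have hint := G.integrable_laplaceFunctional hr hα ht hcyc x₀ hTt hl
  have hmeas : MeasurableSet (G.flowCone x₀ t) := (G.isOpen_flowCone x₀ t).measurableSet
  have hderiv : ∀ w ∈ G.flowCone x₀ t, HasFDerivWithinAt (G.flowChart x₀ t)
      (Matrix.toLin' (G.flowJacobian x₀ t w)).toContinuousLinearMap (G.flowCone x₀ t) w :=
    fun w hw => (G.hasFDerivAt_flowChart hw).hasFDerivWithinAt
  have hinj := G.injOn_flowChart (x₀ := x₀) ht hcyc
  have hcongr : Set.EqOn _ _ (G.flowCone x₀ t) := fun w hw => G.jacobian_smul_eq ht hcyc hTt α l hw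
  refine ⟨?_, hdet, hint, ?_, fun p hp Ω _ ℙ X hX e => hX.expectedCrossings_eq hp (hdet p hp) e⟩
  · rw [G.hyperIntegrable_iff ht hsec hTt]
    -- Integrability is known under the Dirichlet law; the change of variables carries it to the
    -- flows, up to the nonzero factor C_α.
    rw [G.integrable_dirichletLaw_iff hr ht hα, ← G.image_flowChart hG ht hcyc,
      integrableOn_image_iff_integrableOn_abs_det_fderiv_smul volume hmeas hderiv hinj,
      integrableOn_congr_fun hcongr hmeas] at hint
    have hC : (G.normConst α : ℂ) ≠ 0 := Complex.ofReal_ne_zero.mpr (G.normConst_pos hr hα).ne'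
    refine (hint.const_mul (G.normConst α : ℂ)⁻¹).congr (Filter.Eventually.of_forall fun w => ?_)
    exact inv_mul_cancel_left₀ hC _
  · refine Eq.trans ?_ (G.integral_dirichletLaw_eq hr ht hα (G.laplaceFunctional x₀ T l)).symm
    rw [← G.image_flowChart hG ht hcyc,
      integral_image_eq_integral_abs_det_fderiv_smul volume hmeas hderiv hinj,
      setIntegral_congr_fun hmeas hcongr, G.hyperIntegral_eq ht hsec hTt, integral_const_mul]

end
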